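/- Setting. Write $\mathrm{sh}=\sinh$. Let $N\ge 2$ be even and $\eta,\beta,\varphi\in\mathbb C$ with $\mathrm{sh}(\eta)\neq0$. Put $$b(\lambda,\mu)=\frac{\mathrm{sh}(\lambda-\mu)}{\mathrm{sh}(\lambda-\mu+\eta)},\qquad c(\lambda,\mu)=\frac{\mathrm{sh}(\eta)}{\mathrm{sh}(\lambda-\mu+\eta)},\qquad R(\lambda,\mu)=\begin{pmatrix}1&0&0&0\\0&b&c&0\\0&c&b&0\\0&0&0&1\end{pmatrix}\in\mathrm{End}(\mathbb C^2\otimes\mathbb C^2).$$ The monodromy matrix of the quantum transfer matrix, acting on an auxiliary space $j$ and on $N$ quantum spaces $\bar1,\dots,\bar N$ (all equal to $\mathbb C^2$), with twist $\varphi$ ($\varphi=h/2T$ for a magnetic field $h$ at temperature $T$), is $$T(\lambda)=\begin{pmatrix}A(\lambda)&B(\lambda)\\C(\lambda)&D(\lambda)\end{pmatrix}_j=R_{j\bar N}\bigl(\lambda,\tfrac\beta N\bigr)R^{t_1}_{\overline{N-1}\,j}\bigl(-\tfrac\beta N,\lambda\bigr)\cdots R_{j\bar 2}\bigl(\lambda,\tfrac\beta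 N\bigr)R^{t_1}_{\bar1j}\bigl(-\tfrac\beta N,\lambda\bigr)\begin{pmatrix}e^{\varphi}&0\\0&e^{-\varphi}\end{pmatrix}_j,$$ where $t_1$ is transposition in the first of the two spaces of $R$. $T^\alpha_\beta(\lambda)$ denotes the entry in row $\alpha$ and column $\beta$, so that $T^1_1=A$, $T^1_2=B$, $T^2_1=C$, $T^2_2=D$. Let $|0\rangle=\bigl[\binom01\otimes\binom10\bigr]^{\otimes N/2}$, let $\langle0|$ be its transpose, and let $a(\lambda)=e^{\varphi}b^{N/2}(-\tfrac\beta N,\lambda)$ and $d(\lambda)=e^{-\varphi}b^{N/2}(\lambda,\tfrac\beta N)$ be the vacuum eigenvalues of $A(\lambda)$ and $D(\lambda)$. Let $m,M\ge0$ and $\lambda_1,\dots,\lambda_{M+m}\in\mathbb C$ be mutually distinct modulo $i\pi$, and such that all expressions below are defined: $\mathrm{sh}(\lambda_j-\lambda_k+\eta)\ne0$ for $j\neq k$, and, for all $j$, $\mathrm{sh}(\lambda_j-\frac\beta N+\eta)\ne0$, $\mathrm{sh}(-\frac\beta N-\lambda_j+\eta)\neq0$ (no pole of $T$) and $\mathrm{sh}(\lambda_j+\frac\beta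 N)\neq0$ (that is, $a(\lambda_j)\ne0$). Put $\xi_j=\lambda_{M+j}$ and $$\mathfrak b_M(\lambda)=\frac{d(\lambda)}{a(\lambda)}\prod_{k=1}^M\frac{\mathrm{sh}(\lambda-\lambda_k+\eta)}{\mathrm{sh}(\lambda-\lambda_k-\eta)}.$$ Let $(\alpha_n)_{n=1}^m,(\beta_n)_{n=1}^m$ be sequences in $\{1,2\}$ ($1$ is spin-up, $2$ is spin-down). Let $|\alpha^+|$ be the number of up-spins in $(\alpha_n)$ and $\alpha^+_j$ the position of the $j$-th of them; let $|\beta^-|$ be the number of down-spins in $(\beta_n)$ and $\beta_k^-$ the position of the $k$-th of them. Assume that $|\alpha^+|+|\beta^-|=m$ (conservation of $S^z$), and put $\widetilde\alpha^+_j=\alpha^+_{|\alpha^+|-j+1}$ for $1\le j\le|\alpha^+|$ and $\widetilde\beta^-_j=\beta^-_{j-|\alpha^+|}$ for $|\alpha^+|<j\le m$. For $\ell_1,\dots,\ell_m\in\{1,\dots,M+m\}$ put $|\ell^+|=\mathrm{card}(\{1,\dots,M\}\cap\{\ell_1,\dots,\ell_m\})$. Claim. Then $$\begin{aligned} &\langle0|C(\lambda_1)\cdots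 C(\lambda_M)\,T^{\alpha_1}_{\beta_1}(\xi_1)\cdots T^{\alpha_m}_{\beta_m}(\xi_m)\\ &=\sum_{\substack{\ell_1,\dots,\ell_m=1\\ \ell_j\ne\ell_k\text{ for }j\neq k}}^{M+m}\bigl(-\mathrm{sh}(\eta)\bigr)^{|\ell^+|}\Bigl[\prod_{j=|\alpha^+|+1}^m\mathfrak b_M(\lambda_{\ell_j})\Bigr]\Bigl[\prod_{j=1}^m a(\lambda_{\ell_j})\prod_{\substack{k=1\\k\neq\ell_j}}^M\frac1{b(\lambda_k,\lambda_{\ell_j})}\Bigr]\\ &\quad\Bigl[\prod_{1\le j<k\le m}b(\lambda_{\ell_k},\lambda_{\ell_j})\Bigr]\Bigl[\prod_{j=1}^m\prod_{\substack{k=1\\k+M\ne\ell_j}}^m\frac1{\mathrm{sh}(\lambda_{\ell_j}-\xi_k)}\Bigr]\\ &\quad\Bigl[\prod_{j=1}^{|\alpha^+|}\prod_{k=1}^{\widetilde\alpha_j^+-1}\mathrm{sh}(\lambda_{\ell_j}-\xi_k-\eta)\prod_{k=\widetilde\alpha_j^++1}^m\mathrm{sh}(\lambda_{\ell_j}-\xi_k)\Bigr]\\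 &\quad\Bigl[\prod_{j=|\alpha^+|+1}^{m}\prod_{k=1}^{\widetilde\beta_j^--1}\mathrm{sh}(\lambda_{\ell_j}-\xi_k+\eta)\prod_{k=\widetilde\beta_j^-+1}^m\mathrm{sh}(\lambda_{\ell_j}-\xi_k)\Bigr]\;\langle0|\prod_{\substack{k=1\\k\neq\ell_1,\dots,\ell_m}}^{M+m}C(\lambda_k). \end{aligned}$$ The $\lambda_j$ are not required to satisfy any Bethe equations. -/

import Mathlib

open Complex
open scoped Matrix

noncomputable section

namespace XXZ

/-- `b(λ, μ) = sh(λ - μ) / sh(λ - μ + η)`. -/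
def b (η l u : ℂ) : ℂ := sinh (l - u) / sinh (l - u + η)

/-- `c(λ, μ) = sh(η) / sh(λ - μ + η)`. -/
def c (η l u : ℂ) : ℂ := sinh η / sinh (l - u + η)

/-- The six-vertex `R`-matrix on `ℂ² ⊗ ℂ²`. The basis vectors `1, 2` of `ℂ²` are labelled
`0, 1 : Fin 2`; rows and columns are labelled by pairs (first space, second space). -/
def R (η l u : ℂ) : Matrix (Fin 2 × Fin 2) (Fin 2 × Fin 2) ℂ :=
  Matrix.of fun p q =>
    if p = q then (if p.1 = p.2 then 1 else b η l u)
    else if p = q.swap then c η l u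
    else 0

/-- Transposition with respect to the first of the two spaces. -/
def transposeFst (X : Matrix (Fin 2 × Fin 2) (Fin 2 × Fin 2) ℂ) :
    Matrix (Fin 2 × Fin 2) (Fin 2 × Fin 2) ℂ :=
  Matrix.of fun p q => X (q.1, p.2) (p.1, q.2)

/-- Operators on the quantum space `(ℂ²)^{⊗ N}`, as matrices in the standard tensor product
basis, which is indexed by `Fin N → Fin 2`. The element `k : Fin N` stands for the site `k + 1`. -/
abbrev QOp (N : ℕ) := Matrix (Fin N → Fin 2) (Fin N → Fin 2) ℂ

/-- `X` acting on (auxiliary space) ⊗ (site `k`), as a `2 × 2` matrix in the auxiliary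
space with entries in the operators on the quantum space. -/
def embedAuxSite {N : ℕ} (k : Fin N) (X : Matrix (Fin 2 × Fin 2) (Fin 2 × Fin 2) ℂ) :
    Matrix (Fin 2) (Fin 2) (QOp N) :=
  Matrix.of fun i j => Matrix.of fun s t =>
    if ∀ k', k' ≠ k → s k' = t k' then X (i, s k) (j, t k) else 0

/-- `X` acting on (site `k`) ⊗ (auxiliary space), as a `2 × 2` matrix in the auxiliary
space with entries in the operators on the quantum space. -/
def embedSiteAux {N : ℕ} (k : Fin N) (X : Matrix (Fin 2 × Fin 2) (Fin 2 × Fin 2) ℂ) :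
    Matrix (Fin 2) (Fin 2) (QOp N) :=
  Matrix.of fun i j => Matrix.of fun s t =>
    if ∀ k', k' ≠ k → s k' = t k' then X (s k, i) (t k, j) else 0

/-- The factor of the monodromy matrix belonging to the site `k + 1`: it is `R_{j, k+1}(λ, β/N)`
if the number `k + 1` of the site is even, and `R_{k+1, j}^{t₁}(-β/N, λ)` if it is odd. -/
def siteFactor (N : ℕ) (η β l : ℂ) (k : Fin N) : Matrix (Fin 2) (Fin 2) (QOp N) :=
  if Even ((k : ℕ) + 1) then embedAuxSite k (R η l (β / N))
  else embedSiteAux k (transposeFst (R η (-(β / N)) l))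

/-- The twist `diag(e^φ, e^{-φ})` in the auxiliary space; `φ = h / (2T)` for a field `h`. -/
def twist (N : ℕ) (φ : ℂ) : Matrix (Fin 2) (Fin 2) (QOp N) :=
  Matrix.diagonal ![exp φ • (1 : QOp N), exp (-φ) • (1 : QOp N)]

/-- The (twisted) monodromy matrix of the quantum transfer matrix,
`T(λ) = R_{jN}(λ, β/N) R_{N-1,j}^{t₁}(-β/N, λ) ⋯ R_{j2}(λ, β/N) R_{1j}^{t₁}(-β/N, λ) diag(e^φ, e^{-φ})`.
Its entry in row `i` and column `j` is `T^i_j(λ)`, so `T = (A B; C D)`. -/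
def T (N : ℕ) (η β φ l : ℂ) : Matrix (Fin 2) (Fin 2) (QOp N) :=
  ((List.finRange N).reverse.map (siteFactor N η β l)).prod * twist N φ

/-- The lower left entry `C(λ)` of the monodromy matrix. -/
def C (N : ℕ) (η β φ l : ℂ) : QOp N := T N η β φ l 1 0

/-- The pseudo vacuum `[(0,1) ⊗ (1,0)]^{⊗ N/2}` (a real vector, so that the same family of
coordinates also gives the row vector `⟨0|`). -/
def vac (N : ℕ) : (Fin N → Fin 2) → ℂ :=
  Pi.single (fun k => if Even ((k : ℕ) + 1) then 0 else 1) 1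

/-- The vacuum expectation value `a(λ)` of `A(λ)`. -/
def a (N : ℕ) (η β φ l : ℂ) : ℂ := exp φ * b η (-(β / N)) l ^ (N / 2)

/-- The vacuum expectation value `d(λ)` of `D(λ)`. -/
def d (N : ℕ) (η β φ l : ℂ) : ℂ := exp (-φ) * b η l (β / N) ^ (N / 2)

/-- `𝔟_M(λ) = d(λ) / a(λ) ∏_{k=1}^M sh(λ - λ_k + η) / sh(λ - λ_k - η)`. -/
def bM (N : ℕ) (η β φ : ℂ) {M : ℕ} (lam : Fin M → ℂ) (l : ℂ) : ℂ :=
  d N η β φ l / a N η β φ l * ∏ k, sinh (l - lam k + η) / sinh (l - lam k - η)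

/-- The set of positions of the up-spins (value `0 : Fin 2`). -/
def upSet {m : ℕ} (α : Fin m → Fin 2) : Finset (Fin m) := Finset.univ.filter fun j => α j = 0

/-- The set of positions of the down-spins (value `1 : Fin 2`). -/
def downSet {m : ℕ} (α : Fin m → Fin 2) : Finset (Fin m) := Finset.univ.filter fun j => α j = 1

/-- The positions of the up-spins, in decreasing order: `α̃⁺_j = α⁺_{|α⁺| - j + 1}`. -/
def alphaTilde {m : ℕ} (α : Fin m → Fin 2) (j : Fin (upSet α).card) : Fin m :=
  (upSet α).orderEmbOfFin rfl j.rev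

/-- The positions of the down-spins, in increasing order: `j : Fin |β⁻|` stands for the
index `|α⁺| + j + 1`. -/
def betaTilde {m : ℕ} (β : Fin m → Fin 2) (j : Fin (downSet β).card) : Fin m :=
  (downSet β).orderEmbOfFin rfl j

section Coefficient

variable (N : ℕ) (η β φ : ℂ) {M m : ℕ} (lam : Fin (M + m) → ℂ)
  (al be : Fin m → Fin 2) (hz : (upSet al).card + (downSet be).card = m)
  (ℓ : Fin m ↪ Fin (M + m))

/-- The inhomogeneities `ξ_j = λ_{M+j}`. -/
def xi (j : Fin m) : ℂ := lam (Fin.natAdd M j)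

/-- `|ℓ⁺| = card ({1, …, M} ∩ {ℓ_j})`. -/
def ellPlus : ℕ := ((Finset.univ.image ℓ).filter fun i : Fin (M + m) => (i : ℕ) < M).card

/-- The coefficient of `⟨0| ∏_{k ≠ ℓ_1, …, ℓ_m} C(λ_k)` in the general left action. Under
`hz` the numbers `1, …, m` are split into `1, …, |α⁺|` and `|α⁺| + 1, …, m`. -/
def coeff : ℂ :=
  (-sinh η) ^ ellPlus ℓ
  * (∏ j : Fin (downSet be).card,
      bM N η β φ (fun k : Fin M => lam (Fin.castAdd m k)) (lam (ℓ (Fin.cast hz (Fin.natAdd _ j)))))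
  * (∏ j : Fin m, (a N η β φ (lam (ℓ j))
      * ∏ k : Fin M with Fin.castAdd m k ≠ ℓ j, 1 / b η (lam (Fin.castAdd m k)) (lam (ℓ j))))
  * (∏ j : Fin m, ∏ k ∈ Finset.Ioi j, b η (lam (ℓ k)) (lam (ℓ j)))
  * (∏ j : Fin m, ∏ k : Fin m with Fin.natAdd M k ≠ ℓ j, 1 / sinh (lam (ℓ j) - xi lam k))
  * (∏ j : Fin (upSet al).card,
      ((∏ k ∈ Finset.Iio (alphaTilde al j),
          sinh (lam (ℓ (Fin.cast hz (Fin.castAdd _ j))) - xi lam k - η))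
        * ∏ k ∈ Finset.Ioi (alphaTilde al j),
          sinh (lam (ℓ (Fin.cast hz (Fin.castAdd _ j))) - xi lam k)))
  * (∏ j : Fin (downSet be).card,
      ((∏ k ∈ Finset.Iio (betaTilde be j),
          sinh (lam (ℓ (Fin.cast hz (Fin.natAdd _ j))) - xi lam k + η))
        * ∏ k ∈ Finset.Ioi (betaTilde be j),
          sinh (lam (ℓ (Fin.cast hz (Fin.natAdd _ j))) - xi lam k)))

/-- The product of the `C(λ_k)` over all `k` outside the range of `ℓ`, in increasing order. -/
def remainingC : QOp N :=
  (((List.finRange (M + m)).filter fun k => ∀ j, k ≠ ℓ j).map fun k => C N η β φ (lam k)).prod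

end Coefficient

end XXZ

end

/-!
Write `C_k, A_k, …` for the entries of the monodromy matrix `T(λ_k)`. The monodromy matrix
satisfies the relations of the Yang-Baxter algebra, since its factors do (`T_intertwines`), and
`⟨0|` is a left vacuum (`isLeftVacuum_T`). In particular the `C_k` commute, so that the row vector
`⟨S| = ⟨0| ∏_{k ∈ S} C_k` is defined for every finite set `S` of indices. For `U = S ∪ {x}`,
`x ∉ S`, one has

* `⟨S| A_x = ∑_{p ∈ U} a(p) c(x, p) ∏_{k ∈ U \ p} b(k, p)⁻¹ ⟨U \ p|`,
* `⟨S| D_x = ∑_{q ∈ U} d(q) c(q, x) ∏_{k ∈ U \ q} b(q, k)⁻¹ ⟨U \ q|`,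
* `⟨S| B_x = ∑_{p, q ∈ U} (product of the two weights above) b(q, p) ⟨U \ {p, q}|`,
* `⟨S| C_x = ⟨U|`.

Since `b(p, p) = 0` and `c(p, p) = 1`, the index `x` plays no special role in these sums. This is
why they follow by induction on `S` from the commutation relations: at each step the coefficient of
every vector reduces to one of the three scalar identities `b_mul_c_left`, `b_mul_c_right` and
`c_eq_add`, whatever coincidences there are between `p`, `q`, `x` and the other indices.

The action of a product of entries (`VacuumRep.state_vecMul_prod`) follows by induction on the
number of operators, where the first operator is split off. If it removes `k`, then the weight of
every up-spin `p` that is removed later is multiplied by `b(k, p)`, and that of every down-spin `q`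
by `b(q, k)` (`weight_erase`). These factors make up the product over the pairs of removed indices.
As `b(p, p) = 0`, this product also takes care of the restriction to distinct indices.

Finally, `weight_up_eq` and `weight_down_eq` express the weight of a spin at position `t` by
hyperbolic functions: the factors `1 / sh(λ - ξ_k)` and `sh(λ - ξ_k ∓ η)`, `k < t`, are those of
`1 / b`, the factors with `k > t` cancel, and for `λ = ξ_k` with `k > t` both sides vanish, as
`⟨S| T(ξ_1) ⋯ T(ξ_t)` does not yet contain `C(ξ_k)`.
-/

namespace XXZ

/-! ### Weights of the six-vertex model -/

lemma b_self (η l : ℂ) : b η l l = 0 := by simp [b]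

lemma c_self {η : ℂ} (hη : sinh η ≠ 0) (l : ℂ) : c η l l = 1 := by simp [c, hη]

lemma b_ne_zero {η l u : ℂ} (h : sinh (l - u) ≠ 0) (h' : sinh (l - u + η) ≠ 0) :
    b η l u ≠ 0 := div_ne_zero h h'

/-- Up to relabelling, this and the next two identities are the components of the Yang-Baxter
equation of the six-vertex model. -/
lemma b_mul_c_left {η x y z : ℂ} (hxy : sinh (x - y + η) ≠ 0) (hyz : sinh (y - z + η) ≠ 0)
    (hxz : sinh (x - z + η) ≠ 0) :
    b η x y * c η y z = b η x z * c η y z - c η x y * b η y z * c η x z := by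
  simp only [b, c]
  field_simp
  simp only [Complex.sinh, neg_add_rev, neg_sub, exp_add, exp_sub, exp_neg]
  field_simp
  ring

lemma b_mul_c_right {η x y z : ℂ} (hxy : sinh (x - y + η) ≠ 0) (hyz : sinh (y - z + η) ≠ 0)
    (hxz : sinh (x - z + η) ≠ 0) :
    b η y z * c η x y = b η x z * c η x y - c η y z * b η x y * c η x z := by
  simp only [b, c]
  field_simp
  simp only [Complex.sinh, neg_add_rev, neg_sub, exp_add, exp_sub, exp_neg]
  field_simp
  ring

lemma c_eq_add {η x y z : ℂ} (hxy : sinh (x - y + η) ≠ 0) (hyz : sinh (y - z + η) ≠ 0)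
    (hxz : sinh (x - z + η) ≠ 0) :
    c η x z = b η x y * b η y z * c η x z + c η x y * c η y z := by
  simp only [b, c]
  field_simp
  simp only [Complex.sinh, neg_add_rev, neg_sub, exp_add, exp_sub, exp_neg]
  field_simp
  ring

/-! ### Operators on a single site -/

variable {N : ℕ}

/-- The operator on the quantum space that acts as `X` on the site `k` and trivially on all
others. -/
def siteHom (k : Fin N) : Matrix (Fin 2) (Fin 2) ℂ →ₗ[ℂ] QOp N where
  toFun X := Matrix.of fun s t => if ∀ k', k' ≠ k → s k' = t k' then X (s k) (t k) else 0
  map_add' X Y := by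
    ext s t
    by_cases h : ∀ k', k' ≠ k → s k' = t k'
    · simp only [Matrix.of_apply, Matrix.add_apply, if_pos h]
    · simp only [Matrix.of_apply, Matrix.add_apply, if_neg h, add_zero]
  map_smul' r X := by
    ext s t
    by_cases h : ∀ k', k' ≠ k → s k' = t k'
    · simp only [Matrix.of_apply, Matrix.smul_apply, if_pos h, RingHom.id_apply]
    · simp only [Matrix.of_apply, Matrix.smul_apply, if_neg h, smul_zero]

lemma vecMul_siteHom (k : Fin N) (X : Matrix (Fin 2) (Fin 2) ℂ) (v : (Fin N → Fin 2) → ℂ)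
    (t : Fin N → Fin 2) :
    (v ᵥ* siteHom k X) t = ∑ i, v (Function.update t k i) * X i (t k) := by
  have key (s : Fin N → Fin 2) : v s * siteHom k X s t
      = ∑ i, if s = Function.update t k i then v s * X i (t k) else 0 := by
    have h0 : (∀ k', k' ≠ k → s k' = t k') ↔ s = Function.update t k (s k) := by
      rw [Function.eq_update_iff]; simp
    have h1 (i : Fin 2) : s = Function.update t k i ↔
        i = s k ∧ s = Function.update t k (s k) := by
      constructor
      · intro h
        have : s k = i := by rw [h]; simp
        subst this
        exact ⟨rfl, h⟩
      · rintro ⟨rfl, h⟩; exact h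
    by_cases h : s = Function.update t k (s k)
    · have h2 (i : Fin 2) : s = Function.update t k i ↔ i = s k := by
        rw [h1]; exact ⟨fun h => h.1, fun h' => ⟨h', h⟩⟩
      simp only [siteHom, LinearMap.coe_mk, AddHom.coe_mk, Matrix.of_apply, h0, h2]
      simp
    · have h2 (i : Fin 2) : ¬ s = Function.update t k i := by rw [h1]; exact fun h' => h h'.2
      simp only [siteHom, LinearMap.coe_mk, AddHom.coe_mk, Matrix.of_apply, h0, h2]
      simp
  simp only [Matrix.vecMul, dotProduct, key]
  rw [Finset.sum_comm]
  simp

lemma siteHom_one (k : Fin N) : siteHom k 1 = 1 := by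
  refine Matrix.ext_iff_vecMul.mpr fun v => ?_
  ext t
  rw [vecMul_siteHom]
  simp [Matrix.one_apply]

lemma siteHom_mul (k : Fin N) (X Y : Matrix (Fin 2) (Fin 2) ℂ) :
    siteHom k (X * Y) = siteHom k X * siteHom k Y := by
  refine Matrix.ext_iff_vecMul.mpr fun v => ?_
  ext t
  rw [← Matrix.vecMul_vecMul, vecMul_siteHom, vecMul_siteHom]
  simp only [vecMul_siteHom, Function.update_self, Function.update_idem, Matrix.mul_apply,
    Finset.mul_sum, Finset.sum_mul]
  rw [Finset.sum_comm]
  simp only [mul_assoc]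

/-- Operators on different sites commute. -/
lemma siteHom_commute {k l : Fin N} (h : k ≠ l) (X Y : Matrix (Fin 2) (Fin 2) ℂ) :
    Commute (siteHom k X) (siteHom l Y) := by
  refine Matrix.ext_iff_vecMul.mpr fun v => ?_
  ext t
  rw [← Matrix.vecMul_vecMul, ← Matrix.vecMul_vecMul, vecMul_siteHom, vecMul_siteHom]
  simp only [vecMul_siteHom, Finset.sum_mul, Function.update_of_ne h, Function.update_of_ne h.symm]
  rw [Finset.sum_comm]
  refine Finset.sum_congr rfl fun i _ => Finset.sum_congr rfl fun j _ => ?_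
  rw [Function.update_comm h]
  ring

/-- `siteHom` as a homomorphism of algebras. -/
def siteAlgHom (k : Fin N) : Matrix (Fin 2) (Fin 2) ℂ →ₐ[ℂ] QOp N :=
  AlgHom.ofLinearMap (siteHom k) (siteHom_one k) (siteHom_mul k)

/-! ### The Yang-Baxter algebra -/

section Intertwines

variable {𝒜 ℬ : Type*} [Ring 𝒜] [Algebra ℂ 𝒜] [Ring ℬ] [Algebra ℂ ℬ]

/-- The relation `X L₁ M₂ = M₂ L₁ X` in `End(ℂ² ⊗ ℂ²) ⊗ 𝒜`, where `L₁` and `M₂` stand for `L` and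
`M` acting on the first and on the second auxiliary space, with entries in the (noncommutative)
algebra `𝒜`. -/
def Intertwines (X : Matrix (Fin 2 × Fin 2) (Fin 2 × Fin 2) ℂ) (L M : Matrix (Fin 2) (Fin 2) 𝒜) :
    Prop :=
  ∀ p q : Fin 2 × Fin 2, ∑ r, X p r • (L r.1 q.1 * M r.2 q.2) = ∑ r, X r q • (M p.2 r.2 * L p.1 r.1)

/-- If the entries of the factors commute, then the relation is inherited by products:
this is the coproduct of the Yang-Baxter algebra. -/
lemma Intertwines.mul {X : Matrix (Fin 2 × Fin 2) (Fin 2 × Fin 2) ℂ}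
    {L M L' M' : Matrix (Fin 2) (Fin 2) 𝒜} (h : Intertwines X L M) (h' : Intertwines X L' M')
    (hc : ∀ i j k l, Commute (L' i j) (M k l)) (hc' : ∀ i j k l, Commute (L i j) (M' k l)) :
    Intertwines X (L * L') (M * M') := by
  intro p q
  have e1 (r : Fin 2 × Fin 2) : (L * L') r.1 q.1 * (M * M') r.2 q.2
      = ∑ s : Fin 2 × Fin 2, L r.1 s.1 * M r.2 s.2 * (L' s.1 q.1 * M' s.2 q.2) := by
    simp only [Matrix.mul_apply, Finset.sum_mul_sum, Fintype.sum_prod_type]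
    refine Finset.sum_congr rfl fun i _ => Finset.sum_congr rfl fun j _ => ?_
    rw [mul_assoc, ← mul_assoc (L' i q.1), (hc i q.1 r.2 j).eq, mul_assoc, mul_assoc]
  have e2 (r : Fin 2 × Fin 2) : (M * M') p.2 r.2 * (L * L') p.1 r.1
      = ∑ s : Fin 2 × Fin 2, M p.2 s.2 * L p.1 s.1 * (M' s.2 r.2 * L' s.1 r.1) := by
    simp only [Matrix.mul_apply, Finset.sum_mul_sum, Fintype.sum_prod_type]
    rw [Finset.sum_comm]
    refine Finset.sum_congr rfl fun i _ => Finset.sum_congr rfl fun j _ => ?_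
    rw [mul_assoc, ← mul_assoc (M' j r.2), ← (hc' p.1 i j r.2).eq, mul_assoc, mul_assoc]
  calc ∑ r, X p r • ((L * L') r.1 q.1 * (M * M') r.2 q.2)
      = ∑ s : Fin 2 × Fin 2, (∑ r, X p r • (L r.1 s.1 * M r.2 s.2)) *
          (L' s.1 q.1 * M' s.2 q.2) := by
        simp only [e1, Finset.smul_sum, Finset.sum_mul, smul_mul_assoc]
        rw [Finset.sum_comm]
    _ = ∑ s : Fin 2 × Fin 2, (M p.2 s.2 * L p.1 s.1) *
          ∑ r, X s r • (L' r.1 q.1 * M' r.2 q.2) := by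
        simp only [h p, Finset.mul_sum, Finset.sum_mul, smul_mul_assoc, mul_smul_comm]
        rw [Finset.sum_comm]
    _ = ∑ r, X r q • ((M * M') p.2 r.2 * (L * L') p.1 r.1) := by
        simp only [h' _ q, e2, Finset.mul_sum, Finset.smul_sum, mul_smul_comm]
        rw [Finset.sum_comm]

lemma Intertwines.map {X : Matrix (Fin 2 × Fin 2) (Fin 2 × Fin 2) ℂ}
    {L M : Matrix (Fin 2) (Fin 2) 𝒜} (h : Intertwines X L M) (f : 𝒜 →ₐ[ℂ] ℬ) :
    Intertwines X (L.map f) (M.map f) := by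
  intro p q
  have := congrArg f (h p q)
  simpa only [map_sum, map_smul, map_mul, Matrix.map_apply] using this

lemma Intertwines.one (X : Matrix (Fin 2 × Fin 2) (Fin 2 × Fin 2) ℂ) :
    Intertwines X (1 : Matrix (Fin 2) (Fin 2) 𝒜) 1 := by
  intro p q
  have e1 (r : Fin 2 × Fin 2) : (1 : Matrix (Fin 2) (Fin 2) 𝒜) r.1 q.1
      * (1 : Matrix (Fin 2) (Fin 2) 𝒜) r.2 q.2 = if r = q then 1 else 0 := by
    simp only [Matrix.one_apply, Prod.ext_iff]
    split_ifs <;> simp_all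
  have e2 (r : Fin 2 × Fin 2) : (1 : Matrix (Fin 2) (Fin 2) 𝒜) p.2 r.2
      * (1 : Matrix (Fin 2) (Fin 2) 𝒜) p.1 r.1 = if p = r then 1 else 0 := by
    simp only [Matrix.one_apply, Prod.ext_iff]
    split_ifs <;> simp_all
  simp [e1, e2]

/-- The `R`-matrix commutes with `G ⊗ G` for a diagonal matrix `G` of scalars. -/
lemma Intertwines.diagonal (η l u : ℂ) (g : Fin 2 → ℂ) :
    Intertwines (R η l u) (Matrix.diagonal fun i => g i • (1 : 𝒜))
      (Matrix.diagonal fun i => g i • (1 : 𝒜)) := by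
  rintro ⟨p, p'⟩ ⟨q, q'⟩
  fin_cases p <;> fin_cases p' <;> fin_cases q <;> fin_cases q' <;>
    simp [Fintype.sum_prod_type, R, Matrix.diagonal, smul_comm (g 0) (g 1)]

end Intertwines

/-- The factor of the monodromy matrix at an even site, as a `2 × 2` matrix in the auxiliary space
of operators on the site. -/
def auxR (X : Matrix (Fin 2 × Fin 2) (Fin 2 × Fin 2) ℂ) :
    Matrix (Fin 2) (Fin 2) (Matrix (Fin 2) (Fin 2) ℂ) :=
  Matrix.of fun i j => Matrix.of fun s t => X (i, s) (j, t)

/-- The factor of the monodromy matrix at an odd site, as a `2 × 2` matrix in the auxiliary space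
of operators on the site. -/
def auxRt (X : Matrix (Fin 2 × Fin 2) (Fin 2 × Fin 2) ℂ) :
    Matrix (Fin 2) (Fin 2) (Matrix (Fin 2) (Fin 2) ℂ) :=
  Matrix.of fun i j => Matrix.of fun s t => X (t, i) (s, j)

/-- The Yang-Baxter equation `R₁₂ R₁₃ R₂₃ = R₂₃ R₁₃ R₁₂`. -/
lemma intertwines_auxR {η x y z : ℂ} (hxy : sinh (x - y + η) ≠ 0) (hyz : sinh (y - z + η) ≠ 0)
    (hxz : sinh (x - z + η) ≠ 0) :
    Intertwines (R η x y) (auxR (R η x z)) (auxR (R η y z)) := by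
  have h1 := b_mul_c_left hxy hyz hxz
  have h2 := b_mul_c_right hxy hyz hxz
  have h3 := c_eq_add hxy hyz hxz
  rintro ⟨p, p'⟩ ⟨q, q'⟩
  ext s t
  simp only [R, auxR, Fintype.sum_prod_type, Matrix.mul_apply, Matrix.of_apply, Fin.sum_univ_two,
    Matrix.smul_apply, Matrix.add_apply]
  -- each component is trivial or one of the three identities, up to the order of the factors
  fin_cases p <;> fin_cases p' <;> fin_cases q <;> fin_cases q' <;> fin_cases s <;> fin_cases t <;>
    simp [-one_div] <;>
    first
      | exact mul_comm _ _
      | exact Or.inl (mul_comm _ _)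
      | linear_combination h1
      | linear_combination -h1
      | linear_combination h2
      | linear_combination -h2
      | linear_combination h3
      | linear_combination -h3

/-- The Yang-Baxter equation `R₃₁ R₃₂ R₁₂ = R₁₂ R₃₂ R₃₁`, transposed in the third space. -/
lemma intertwines_auxRt {η x y z : ℂ} (hxy : sinh (x - y + η) ≠ 0) (hzx : sinh (z - x + η) ≠ 0)
    (hzy : sinh (z - y + η) ≠ 0) :
    Intertwines (R η x y) (auxRt (R η z x)) (auxRt (R η z y)) := by
  have h1 := b_mul_c_left hzx hxy hzy
  have h2 := b_mul_c_right hzx hxy hzy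
  have h3 := c_eq_add hzx hxy hzy
  rintro ⟨p, p'⟩ ⟨q, q'⟩
  ext s t
  simp only [R, auxRt, Fintype.sum_prod_type, Matrix.mul_apply, Matrix.of_apply, Fin.sum_univ_two,
    Matrix.smul_apply, Matrix.add_apply]
  -- each component is trivial or one of the three identities, up to the order of the factors
  fin_cases p <;> fin_cases p' <;> fin_cases q <;> fin_cases q' <;> fin_cases s <;> fin_cases t <;>
    simp [-one_div] <;>
    first
      | exact mul_comm _ _
      | exact Or.inl (mul_comm _ _)
      | linear_combination h1
      | linear_combination -h1
      | linear_combination h2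
      | linear_combination -h2
      | linear_combination h3
      | linear_combination -h3

lemma siteFactor_of_even {η β l : ℂ} {k : Fin N} (hk : Even ((k : ℕ) + 1)) :
    siteFactor N η β l k = (auxR (R η l (β / N))).map (siteAlgHom k) := by
  rw [siteFactor, if_pos hk]; rfl

lemma siteFactor_of_not_even {η β l : ℂ} {k : Fin N} (hk : ¬ Even ((k : ℕ) + 1)) :
    siteFactor N η β l k = (auxRt (R η (-(β / N)) l)).map (siteAlgHom k) := by
  rw [siteFactor, if_neg hk]; rfl

lemma exists_siteFactor_eq (η β l : ℂ) (k : Fin N) :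
    ∃ X : Matrix (Fin 2) (Fin 2) (Matrix (Fin 2) (Fin 2) ℂ),
      siteFactor N η β l k = X.map (siteAlgHom k) := by
  by_cases hk : Even ((k : ℕ) + 1)
  · exact ⟨_, siteFactor_of_even hk⟩
  · exact ⟨_, siteFactor_of_not_even hk⟩

lemma siteFactor_commute {η β l u : ℂ} {k k' : Fin N} (h : k ≠ k') (i j i' j' : Fin 2) :
    Commute (siteFactor N η β l k i j) (siteFactor N η β u k' i' j') := by
  obtain ⟨X, hX⟩ := exists_siteFactor_eq η β l k
  obtain ⟨Y, hY⟩ := exists_siteFactor_eq η β u k'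
  rw [hX, hY]
  exact siteHom_commute h _ _

lemma siteFactor_intertwines {η β x y : ℂ} (hxy : sinh (x - y + η) ≠ 0)
    (hx : sinh (x - β / N + η) ≠ 0) (hx' : sinh (-(β / N) - x + η) ≠ 0)
    (hy : sinh (y - β / N + η) ≠ 0) (hy' : sinh (-(β / N) - y + η) ≠ 0) (k : Fin N) :
    Intertwines (R η x y) (siteFactor N η β x k) (siteFactor N η β y k) := by
  by_cases hk : Even ((k : ℕ) + 1)
  · rw [siteFactor_of_even hk, siteFactor_of_even hk]
    exact (intertwines_auxR hxy hy hx).map _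
  · rw [siteFactor_of_not_even hk, siteFactor_of_not_even hk]
    exact (intertwines_auxRt hxy hx' hy').map _

/-- The entries of a product of matrices commute with everything that commutes with the entries of
the factors. -/
lemma commute_list_prod {𝒜 κ : Type*} [Ring 𝒜] (f : κ → Matrix (Fin 2) (Fin 2) 𝒜) (x : 𝒜)
    (l : List κ) (h : ∀ k ∈ l, ∀ i j, Commute x (f k i j)) (i j : Fin 2) :
    Commute x ((l.map f).prod i j) := by
  induction l generalizing i j with
  | nil =>
    simp only [List.map_nil, List.prod_nil, Matrix.one_apply]
    split_ifs
    · exact Commute.one_right x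
    · exact Commute.zero_right x
  | cons k l ih =>
    simp only [List.map_cons, List.prod_cons, Matrix.mul_apply]
    refine Commute.sum_right _ _ _ fun r _ => ?_
    exact (h k (by simp) i r).mul_right (ih (fun k' hk' => h k' (by simp [hk'])) r j)

/-- The monodromy matrix satisfies the Yang-Baxter algebra relations. -/
lemma T_intertwines {η β φ x y : ℂ} (hxy : sinh (x - y + η) ≠ 0)
    (hx : sinh (x - β / N + η) ≠ 0) (hx' : sinh (-(β / N) - x + η) ≠ 0)
    (hy : sinh (y - β / N + η) ≠ 0) (hy' : sinh (-(β / N) - y + η) ≠ 0) :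
    Intertwines (R η x y) (T N η β φ x) (T N η β φ y) := by
  have key (l : List (Fin N)) (hl : l.Nodup) :
      Intertwines (R η x y) ((l.map (siteFactor N η β x)).prod)
        ((l.map (siteFactor N η β y)).prod) := by
    induction l with
    | nil => exact Intertwines.one _
    | cons k l ih =>
      rw [List.nodup_cons] at hl
      simp only [List.map_cons, List.prod_cons]
      refine (siteFactor_intertwines hxy hx hx' hy hy' k).mul (ih hl.2) ?_ ?_
      · intro i j i' j'
        refine (commute_list_prod _ _ l (fun k' hk' i j => ?_) i j).symm
        exact siteFactor_commute (by rintro rfl; exact hl.1 hk') _ _ _ _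
      · intro i j i' j'
        refine commute_list_prod _ _ l (fun k' hk' i j => ?_) i' j'
        exact siteFactor_commute (by rintro rfl; exact hl.1 hk') _ _ _ _
  have ht : twist N φ = Matrix.diagonal fun i => (![exp φ, exp (-φ)] i) • (1 : QOp N) := by
    rw [twist]
    congr 1
    ext i
    fin_cases i <;> rfl
  have hcomm (i j i' j' : Fin 2) (z : QOp N) : Commute (twist N φ i j) z := by
    rw [ht, Matrix.diagonal_apply]
    split_ifs
    · exact (Commute.one_left z).smul_left _
    · exact Commute.zero_left z
  rw [T, T]
  refine (key _ (by simpa using List.nodup_finRange N)).mul ?_ (fun i j _ _ => hcomm i j i j _)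
    (fun _ _ i j => (hcomm i j i j _).symm)
  rw [ht]
  exact Intertwines.diagonal η x y _

/-! ### The pseudo vacuum -/

lemma single_vecMul_siteHom (σ : Fin N → Fin 2) (k : Fin N) (X : Matrix (Fin 2) (Fin 2) ℂ) (x : ℂ)
    (h : ∀ j, X (σ k) j = if σ k = j then x else 0) :
    (Pi.single σ 1 : (Fin N → Fin 2) → ℂ) ᵥ* siteHom k X = x • Pi.single σ 1 := by
  ext t
  rw [vecMul_siteHom, Finset.sum_eq_single (σ k)]
  · rw [h]
    by_cases hk : σ k = t k
    · rw [if_pos hk, hk, Function.update_eq_self, Pi.smul_apply, smul_eq_mul, mul_comm]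
    · have : t ≠ σ := by rintro rfl; exact hk rfl
      rw [if_neg hk, mul_zero, Pi.smul_apply, Pi.single_eq_of_ne this, smul_zero]
  · intro i _ hi
    have : Function.update t k i ≠ σ := by rintro rfl; exact hi (by simp)
    rw [Pi.single_eq_of_ne this, zero_mul]
  · simp

/-- The row vector `v` is a left eigenvector of the diagonal entries of `L`, with eigenvalues `x`
and `y`, and is annihilated by the upper right entry. -/
structure IsLeftVacuum {n : Type*} [Fintype n] (v : n → ℂ)
    (L : Matrix (Fin 2) (Fin 2) (Matrix n n ℂ)) (x y : ℂ) : Prop where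
  upper : v ᵥ* L 0 0 = x • v
  lower : v ᵥ* L 1 1 = y • v
  corner : v ᵥ* L 0 1 = 0

lemma IsLeftVacuum.mul {n : Type*} [Fintype n] {v : n → ℂ}
    {L L' : Matrix (Fin 2) (Fin 2) (Matrix n n ℂ)} {x y x' y' : ℂ} (h : IsLeftVacuum v L x y)
    (h' : IsLeftVacuum v L' x' y') (hc : Commute (L 1 0) (L' 0 1)) :
    IsLeftVacuum v (L * L') (x * x') (y * y') := by
  refine ⟨?_, ?_, ?_⟩ <;> rw [Matrix.mul_apply, Fin.sum_univ_two, Matrix.vecMul_add]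
  · rw [← Matrix.vecMul_vecMul, ← Matrix.vecMul_vecMul, h.upper, h.corner, Matrix.zero_vecMul,
      Matrix.smul_vecMul, h'.upper, smul_smul, add_zero]
  · rw [hc.eq, ← Matrix.vecMul_vecMul, ← Matrix.vecMul_vecMul, h'.corner,
      Matrix.zero_vecMul, h.lower, Matrix.smul_vecMul, h'.lower, smul_smul, zero_add]
  · rw [← Matrix.vecMul_vecMul, ← Matrix.vecMul_vecMul, h.upper, h.corner, Matrix.zero_vecMul,
      Matrix.smul_vecMul, h'.corner, smul_zero, add_zero]

lemma isLeftVacuum_siteFactor (η β l : ℂ) (k : Fin N) :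
    IsLeftVacuum (vac N) (siteFactor N η β l k)
      (if Even ((k : ℕ) + 1) then 1 else b η (-(β / N)) l)
      (if Even ((k : ℕ) + 1) then b η l (β / N) else 1) := by
  by_cases hk : Even ((k : ℕ) + 1)
  · simp only [siteFactor_of_even hk, if_pos hk]
    refine ⟨?_, ?_, ?_⟩
    · refine single_vecMul_siteHom _ k _ 1 fun j => ?_
      fin_cases j <;> simp [hk, auxR, R]
    · refine single_vecMul_siteHom _ k _ _ fun j => ?_
      fin_cases j <;> simp [hk, auxR, R]
    · rw [← zero_smul ℂ (vac N)]
      refine single_vecMul_siteHom _ k _ _ fun j => ?_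
      fin_cases j <;> simp [hk, auxR, R]
  · simp only [siteFactor_of_not_even hk, if_neg hk]
    refine ⟨?_, ?_, ?_⟩
    · refine single_vecMul_siteHom _ k _ _ fun j => ?_
      fin_cases j <;> simp [hk, auxRt, R]
    · refine single_vecMul_siteHom _ k _ 1 fun j => ?_
      fin_cases j <;> simp [hk, auxRt, R]
    · rw [← zero_smul ℂ (vac N)]
      refine single_vecMul_siteHom _ k _ _ fun j => ?_
      fin_cases j <;> simp [hk, auxRt, R]

lemma prod_alternating (x y : ℂ) (n : ℕ) :
    (∏ k : Fin (n + n), if Even ((k : ℕ) + 1) then x else y) = y ^ n * x ^ n := by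
  induction n with
  | zero => simp
  | succ n ih =>
    have h1 : ¬ Even (n + n + 1) := by simp
    have h2 : Even (n + n + 1 + 1) := by simp
    rw [show n + 1 + (n + 1) = n + n + 1 + 1 by ring, Fin.prod_univ_castSucc,
      Fin.prod_univ_castSucc]
    simp only [Fin.val_castSucc, Fin.val_last, ih, if_neg h1, if_pos h2]
    ring

/-- `⟨0|` is a left vacuum of the monodromy matrix, with eigenvalues `a(λ)` and `d(λ)`. -/
lemma isLeftVacuum_T (hN : Even N) (η β φ l : ℂ) :
    IsLeftVacuum (vac N) (T N η β φ l) (a N η β φ l) (d N η β φ l) := by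
  have key (L : List (Fin N)) (hL : L.Nodup) :
      IsLeftVacuum (vac N) (L.map (siteFactor N η β l)).prod
      (L.map fun k : Fin N => if Even ((k : ℕ) + 1) then 1 else b η (-(β / N)) l).prod
      (L.map fun k : Fin N => if Even ((k : ℕ) + 1) then b η l (β / N) else 1).prod := by
    induction L with
    | nil => constructor <;> simp
    | cons k L ih =>
      rw [List.nodup_cons] at hL
      simp only [List.map_cons, List.prod_cons]
      refine (isLeftVacuum_siteFactor η β l k).mul (ih hL.2) ?_
      refine commute_list_prod _ _ L (fun k' hk' i j => ?_) 0 1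
      exact siteFactor_commute (by rintro rfl; exact hL.1 hk') _ _ _ _
  have hprod (f : Fin N → ℂ) : ((List.finRange N).reverse.map f).prod = ∏ k, f k := by
    rw [List.map_reverse, List.prod_reverse, ← List.ofFn_eq_map, List.prod_ofFn]
  have ht : IsLeftVacuum (vac N) (twist N φ) (exp φ) (exp (-φ)) := by
    constructor <;> simp [twist, Matrix.diagonal, Matrix.vecMul_smul]
  have hT := (key _ (List.nodup_reverse.mpr (List.nodup_finRange N))).mul ht
    (by simp [twist, Matrix.diagonal])
  rw [hprod, hprod] at hT
  obtain ⟨n, rfl⟩ := hN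
  have hn : (n + n) / 2 = n := by omega
  rw [prod_alternating, prod_alternating, one_pow, mul_one, one_mul, mul_comm _ (exp φ),
    mul_comm _ (exp (-φ))] at hT
  rw [a, d, hn]
  exact hT

/-! ### The left action of a single entry of the monodromy matrix -/

/-- The relations that determine the left action of the monodromy matrices `T i` on the states
`v C(i₁) ⋯ C(iₙ)`: the relations of the Yang-Baxter algebra in which `C` is moved to the right, the
action on the vacuum `v`, and the identities satisfied by the weights. All spectral parameters are
taken from one family, of which `ι` is the index set. -/
structure VacuumRep {ι n : Type*} [Fintype n] [DecidableEq n]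
    (T : ι → Matrix (Fin 2) (Fin 2) (Matrix n n ℂ)) (v : n → ℂ) (b c : ι → ι → ℂ) (a d : ι → ℂ) :
    Prop where
  vac : ∀ i, IsLeftVacuum v (T i) (a i) (d i)
  commute_C : ∀ i j, Commute (T i 1 0) (T j 1 0)
  C_mul_A : ∀ i j, i ≠ j → b i j • (T i 1 0 * T j 0 0)
    = T j 0 0 * T i 1 0 - c i j • (T i 0 0 * T j 1 0)
  C_mul_D : ∀ i j, i ≠ j → b j i • (T i 1 0 * T j 1 1)
    = T j 1 1 * T i 1 0 - c j i • (T i 1 1 * T j 1 0)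
  C_mul_B : ∀ i j, i ≠ j → b i j • (T i 1 0 * T j 0 1)
    = b i j • (T j 0 1 * T i 1 0) + c i j • (T j 0 0 * T i 1 1 - T i 0 0 * T j 1 1)
  b_self : ∀ i, b i i = 0
  c_self : ∀ i, c i i = 1
  b_ne : ∀ i j, i ≠ j → b i j ≠ 0
  b_mul_c_left : ∀ i j k, b i j * c j k = b i k * c j k - c i j * b j k * c i k
  b_mul_c_right : ∀ i j k, b j k * c i j = b i k * c i j - c j k * b i j * c i k
  c_eq_add : ∀ i j k, c i k = b i j * b j k * c i k + c i j * c j k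

/-- The product of `1 / g(k, p)` over all `k ∈ U` other than `p`. -/
noncomputable def invProd {ι : Type*} [DecidableEq ι] (g : ι → ι → ℂ) (U : Finset ι) (p : ι) : ℂ :=
  ∏ k ∈ U.erase p, (g k p)⁻¹

section invProd

variable {ι : Type*} [DecidableEq ι] {g : ι → ι → ℂ} {U : Finset ι}

lemma invProd_erase (hg : ∀ i j, i ≠ j → g i j ≠ 0) {r p : ι} (hr : r ∈ U) (hp : p ≠ r) :
    invProd g (U.erase r) p = invProd g U p * g r p := by
  have : r ∈ U.erase p := Finset.mem_erase.mpr ⟨hp.symm, hr⟩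
  rw [invProd, invProd, ← Finset.mul_prod_erase _ _ this, Finset.erase_right_comm]
  field_simp [hg r p hp.symm]

lemma invProd_insert (hg : ∀ i j, i ≠ j → g i j ≠ 0) {r p : ι} (hr : r ∉ U) (hp : p ≠ r) :
    invProd g U p = invProd g (insert r U) p * g r p := by
  rw [← invProd_erase hg (Finset.mem_insert_self r U) hp, Finset.erase_insert hr]

lemma insert_erase_of_ne {r p : ι} (hp : p ≠ r) :
    insert r (U.erase p) = (insert r U).erase p :=
  (Finset.erase_insert_of_ne hp.symm).symm

end invProd

namespace VacuumRep

variable {ι n : Type*} [Fintype n] [DecidableEq n] [DecidableEq ι]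
  {T : ι → Matrix (Fin 2) (Fin 2) (Matrix n n ℂ)} {v : n → ℂ} {b c : ι → ι → ℂ} {a d : ι → ℂ}
  (h : VacuumRep T v b c a d)

omit [DecidableEq ι] in
include h in
lemma pairwise_commute_C (S : Finset ι) :
    (S : Set ι).Pairwise (Function.onFun Commute fun i => T i 1 0) :=
  fun i _ j _ _ => h.commute_C i j

/-- The row vector `v ∏_{k ∈ S} C(k)`. -/
def state (S : Finset ι) : n → ℂ :=
  v ᵥ* S.noncommProd (fun i => T i 1 0) (h.pairwise_commute_C S)

omit [DecidableEq ι] in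
include h in
lemma b_ne_swap (i j : ι) (hij : i ≠ j) : b j i ≠ 0 := h.b_ne j i hij.symm

omit [DecidableEq ι] in
lemma state_empty : h.state ∅ = v := by simp [state]

lemma state_vecMul_C {S : Finset ι} {r : ι} (hr : r ∉ S) :
    h.state S ᵥ* T r 1 0 = h.state (insert r S) := by
  rw [state, state, Finset.noncommProd_insert_of_notMem' _ _ _ _ hr, Matrix.vecMul_vecMul]

/-- If `C(r)` is applied to a sum over the elements `p` of `W` that are removed from a state, then
the sum may be extended to `p = r`, as `g(r, r) = 0`. -/
lemma sum_state_vecMul_C {g : ι → ι → ℂ} (hg : ∀ i j, i ≠ j → g i j ≠ 0) (hg0 : ∀ i, g i i = 0)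
    {W : Finset ι} {r : ι} (hr : r ∉ W) (f : ι → ℂ) :
    (∑ p ∈ W, (f p * invProd g W p) • h.state (W.erase p)) ᵥ* T r 1 0
      = ∑ p ∈ insert r W, (f p * g r p * invProd g (insert r W) p)
          • h.state ((insert r W).erase p) := by
  rw [Finset.sum_insert hr, hg0, mul_zero, zero_mul, zero_smul, zero_add, Matrix.sum_vecMul]
  refine Finset.sum_congr rfl fun p hp => ?_
  have hpr : p ≠ r := by rintro rfl; exact hr hp
  rw [Matrix.smul_vecMul, h.state_vecMul_C (fun h' => hr (Finset.mem_of_mem_erase h')),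
    invProd_insert hg hr hpr, insert_erase_of_ne hpr]
  congr 1
  ring

/-- The left action of `A(x)`. -/
lemma state_vecMul_A (S : Finset ι) (x : ι) (hx : x ∉ S) :
    h.state S ᵥ* T x 0 0 = ∑ p ∈ insert x S, (a p * c x p * invProd b (insert x S) p)
      • h.state ((insert x S).erase p) := by
  induction S using Finset.induction_on generalizing x with
  | empty => simp [state_empty, (h.vac x).upper, h.c_self, invProd]
  | insert r S hr ih =>
    rw [Finset.mem_insert, not_or] at hx
    obtain ⟨hxr, hxS⟩ := hx
    have hb := h.b_ne r x (Ne.symm hxr)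
    refine smul_right_injective _ hb ?_
    beta_reduce
    rw [← h.state_vecMul_C hr, Matrix.vecMul_vecMul, ← Matrix.vecMul_smul,
      h.C_mul_A r x (Ne.symm hxr), Matrix.vecMul_sub, Matrix.vecMul_smul, ← Matrix.vecMul_vecMul,
      ← Matrix.vecMul_vecMul, ih x hxS, ih r hr,
      h.sum_state_vecMul_C h.b_ne h.b_self (by simp [hr, Ne.symm hxr]),
      h.sum_state_vecMul_C h.b_ne h.b_self (by simp [hxS, hxr]), Finset.insert_comm r x,
      Finset.smul_sum, Finset.smul_sum, ← Finset.sum_sub_distrib]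
    refine Finset.sum_congr rfl fun p _ => ?_
    rw [smul_smul, smul_smul, ← sub_smul]
    congr 1
    linear_combination (-a p * invProd b (insert x (insert r S)) p) * h.b_mul_c_left r x p

/-- The left action of `D(x)`. -/
lemma state_vecMul_D (S : Finset ι) (x : ι) (hx : x ∉ S) :
    h.state S ᵥ* T x 1 1
      = ∑ q ∈ insert x S, (d q * c q x * invProd (fun k q => b q k) (insert x S) q)
          • h.state ((insert x S).erase q) := by
  induction S using Finset.induction_on generalizing x with
  | empty => simp [state_empty, (h.vac x).lower, h.c_self, invProd]
  | insert r S hr ih =>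
    rw [Finset.mem_insert, not_or] at hx
    obtain ⟨hxr, hxS⟩ := hx
    have hb := h.b_ne x r hxr
    refine smul_right_injective _ hb ?_
    beta_reduce
    rw [← h.state_vecMul_C hr, Matrix.vecMul_vecMul, ← Matrix.vecMul_smul,
      h.C_mul_D r x (Ne.symm hxr), Matrix.vecMul_sub, Matrix.vecMul_smul, ← Matrix.vecMul_vecMul,
      ← Matrix.vecMul_vecMul, ih x hxS, ih r hr,
      h.sum_state_vecMul_C h.b_ne_swap h.b_self (by simp [hr, Ne.symm hxr]),
      h.sum_state_vecMul_C h.b_ne_swap h.b_self (by simp [hxS, hxr]), Finset.insert_comm r x,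
      Finset.smul_sum, Finset.smul_sum, ← Finset.sum_sub_distrib]
    refine Finset.sum_congr rfl fun p _ => ?_
    rw [smul_smul, smul_smul, ← sub_smul]
    congr 1
    linear_combination (-d p * invProd (fun k q => b q k) (insert x (insert r S)) p)
      * h.b_mul_c_right p x r

/-- The left action of `A(x) D(r)`; it is symmetric in `x` and `r` up to the weights that contain
these parameters explicitly. -/
lemma state_vecMul_A_vecMul_D {S : Finset ι} {x r : ι} (hx : x ∉ S) (hr : r ∉ S) (hxr : x ≠ r) :
    h.state S ᵥ* (T x 0 0 * T r 1 1)
      = ∑ p ∈ insert x (insert r S), ∑ q ∈ insert x (insert r S),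
          (c x p * b r p * c q r * (a p * d q * b q p * invProd b (insert x (insert r S)) p
              * invProd (fun k q => b q k) (insert x (insert r S)) q))
            • h.state (((insert x (insert r S)).erase p).erase q) := by
  have hr' : r ∉ insert x S := by simp [hr, hxr.symm]
  rw [← Matrix.vecMul_vecMul, h.state_vecMul_A S x hx, Matrix.sum_vecMul, Finset.insert_comm x r,
    Finset.sum_insert hr']
  have h0 (q : ι) : c x r * b r r * c q r * (a r * d q * b q r
      * invProd b (insert r (insert x S)) r * invProd (fun k q => b q k) (insert r (insert x S)) q)
        = 0 := by
    rw [h.b_self]; ring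
  simp only [h0, zero_smul, Finset.sum_const_zero, zero_add]
  refine Finset.sum_congr rfl fun p hp => ?_
  have hpr : p ≠ r := by rintro rfl; exact hr' hp
  have hpU : p ∈ insert r (insert x S) := Finset.mem_insert_of_mem hp
  rw [Matrix.smul_vecMul, h.state_vecMul_D _ r (fun h' => hr' (Finset.mem_of_mem_erase h')),
    insert_erase_of_ne hpr, ← Finset.add_sum_erase _ _ hpU, h.b_self, Finset.smul_sum]
  simp only [mul_zero, zero_mul, zero_smul, zero_add]
  refine Finset.sum_congr rfl fun q hq => ?_
  have hqp : q ≠ p := Finset.ne_of_mem_erase hq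
  rw [smul_smul, invProd_insert h.b_ne hr' hpr, invProd_erase h.b_ne_swap hpU hqp]
  congr 1
  ring

/-- The left action of `B(x)`. -/
lemma state_vecMul_B (S : Finset ι) (x : ι) (hx : x ∉ S) :
    h.state S ᵥ* T x 0 1 = ∑ p ∈ insert x S, ∑ q ∈ insert x S,
      (c x p * c q x * (a p * d q * b q p * invProd b (insert x S) p
          * invProd (fun k q => b q k) (insert x S) q))
        • h.state (((insert x S).erase p).erase q) := by
  induction S using Finset.induction_on with
  | empty => simp [state_empty, (h.vac x).corner, h.b_self]
  | insert r S hr ih =>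
    rw [Finset.mem_insert, not_or] at hx
    obtain ⟨hxr, hxS⟩ := hx
    have hr' : r ∉ insert x S := by simp [hr, Ne.symm hxr]
    have hb := h.b_ne r x (Ne.symm hxr)
    -- the term `B(x) C(r)`: as in `sum_state_vecMul_C`, both sums may be extended to `r`
    have hBC : h.state S ᵥ* T x 0 1 ᵥ* T r 1 0
        = ∑ p ∈ insert r (insert x S), ∑ q ∈ insert r (insert x S),
          (c x p * c q x * b r p * b q r * (a p * d q * b q p * invProd b (insert r (insert x S)) p
              * invProd (fun k q => b q k) (insert r (insert x S)) q))
            • h.state (((insert r (insert x S)).erase p).erase q) := by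
      rw [ih hxS, Finset.sum_insert hr', h.b_self, Matrix.sum_vecMul]
      simp only [mul_zero, zero_mul, zero_smul, Finset.sum_const_zero, zero_add]
      refine Finset.sum_congr rfl fun p hp => ?_
      have hpr : p ≠ r := by rintro rfl; exact hr' hp
      rw [Finset.sum_insert hr', h.b_self, Matrix.sum_vecMul]
      simp only [mul_zero, zero_mul, zero_smul, zero_add]
      refine Finset.sum_congr rfl fun q hq => ?_
      have hqr : q ≠ r := by rintro rfl; exact hr' hq
      rw [Matrix.smul_vecMul, h.state_vecMul_C
          (fun h' => hr' (Finset.mem_of_mem_erase (Finset.mem_of_mem_erase h'))),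
        insert_erase_of_ne hqr, insert_erase_of_ne hpr, invProd_insert h.b_ne hr' hpr,
        invProd_insert h.b_ne_swap hr' hqr]
      congr 1
      ring
    refine smul_right_injective _ hb ?_
    beta_reduce
    rw [← h.state_vecMul_C hr, Matrix.vecMul_vecMul, ← Matrix.vecMul_smul,
      h.C_mul_B r x (Ne.symm hxr), Matrix.vecMul_add, Matrix.vecMul_smul, Matrix.vecMul_smul,
      Matrix.vecMul_sub, ← Matrix.vecMul_vecMul, hBC, h.state_vecMul_A_vecMul_D hxS hr hxr,
      h.state_vecMul_A_vecMul_D hr hxS (Ne.symm hxr), Finset.insert_comm r x]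
    simp only [Finset.smul_sum, ← Finset.sum_sub_distrib, ← Finset.sum_add_distrib]
    refine Finset.sum_congr rfl fun p _ => Finset.sum_congr rfl fun q _ => ?_
    simp only [smul_smul, ← sub_smul, ← add_smul]
    congr 1
    linear_combination (a p * d q * b q p * invProd b (insert x (insert r S)) p
      * invProd (fun k q => b q k) (insert x (insert r S)) q)
      * (-c q x * h.b_mul_c_left r x p - b r p * c x p * h.c_eq_add q r x)

end VacuumRep

/-! ### The left action of a product of entries of the monodromy matrix -/

section Coefficients

variable {ι : Type*} [DecidableEq ι]

/-- The factor that arises when a diagonal entry of `T(x)` acts on the state of the set `W` and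
replaces `W` by `W ∪ {x} \ {p}`. For `A` one has `f = a`, `e = c`, `g = b`; for `D` one has `f = d`
and the arguments of `c` and `b` are interchanged. -/
noncomputable def weight (f : ι → ℂ) (e g : ι → ι → ℂ) (W : Finset ι) (x p : ι) : ℂ :=
  if p ∈ insert x W then f p * e x p * invProd g (insert x W) p else 0

lemma weight_of_notMem {f : ι → ℂ} {e g : ι → ι → ℂ} {W : Finset ι} {x p : ι}
    (hp : p ∉ insert x W) : weight f e g W x p = 0 := if_neg hp

lemma weight_erase {f : ι → ℂ} {e g : ι → ι → ℂ} (hg : ∀ i j, i ≠ j → g i j ≠ 0)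
    (hg0 : ∀ i, g i i = 0) {W : Finset ι} {x p₀ : ι} (h₀ : p₀ ∈ W) (hx : p₀ ≠ x) (p : ι) :
    weight f e g (W.erase p₀) x p = weight f e g W x p * g p₀ p := by
  rw [weight, weight, insert_erase_of_ne hx]
  by_cases hp : p = p₀
  · subst hp; simp [hg0]
  · by_cases hpW : p ∈ insert x W
    · rw [if_pos (Finset.mem_erase.mpr ⟨hp, hpW⟩), if_pos hpW,
        invProd_erase hg (Finset.mem_insert_of_mem h₀) hp]
      ring
    · rw [if_neg (fun h => hpW (Finset.mem_of_mem_erase h)), if_neg hpW, zero_mul]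

variable (b c : ι → ι → ℂ) (a d : ι → ℂ)

/-- The coefficient with which the left action of a product of entries of `T(x₁), …, T(xₘ)` on the
state of `S` removes `p i` at the `i`-th up-spin, situated at position `u i`, and `q j` at the
`j`-th down-spin, situated at position `v j`. It vanishes unless all `p i` and `q j` are distinct,
as `b(p, p) = 0`. -/
noncomputable def actionCoeff {m r s : ℕ} (S : Finset ι) (x : Fin m → ι) (u : Fin r → Fin m)
    (v : Fin s → Fin m) (p : Fin r → ι) (q : Fin s → ι) : ℂ :=
  (∏ i, weight a c b (S ∪ (Finset.Iio (u i)).image x) (x (u i)) (p i))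
  * (∏ j, weight d (fun x q => c q x) (fun k q => b q k)
      (S ∪ (Finset.Iio (v j)).image x) (x (v j)) (q j))
  * (∏ i, ∏ i' ∈ Finset.Ioi i, b (p i) (p i'))
  * (∏ i, ∏ j, b (q j) (p i))
  * (∏ j, ∏ j' ∈ Finset.Ioi j, b (q j') (q j))

/-- The factor by which the coefficient changes if `k` is removed from the initial state. -/
noncomputable def removalFactor {r s : ℕ} (p : Fin r → ι) (q : Fin s → ι) (k : ι) : ℂ :=
  (∏ i, b k (p i)) * ∏ j, b (q j) k

variable {b c a d}

lemma actionCoeff_erase (hb : ∀ i j, i ≠ j → b i j ≠ 0) (hb0 : ∀ i, b i i = 0) {m r s : ℕ}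
    {S : Finset ι} {x : Fin m → ι} {k : ι} (hk : k ∈ S) (hx : ∀ j, k ≠ x j) (u : Fin r → Fin m)
    (v : Fin s → Fin m) (p : Fin r → ι) (q : Fin s → ι) :
    actionCoeff b c a d (S.erase k) x u v p q
      = actionCoeff b c a d S x u v p q * removalFactor b p q k := by
  have hS (t : Fin m) : S.erase k ∪ (Finset.Iio t).image x
      = (S ∪ (Finset.Iio t).image x).erase k := by
    rw [Finset.erase_union_distrib, Finset.erase_eq_of_notMem (s := Finset.image x _)]
    simp only [Finset.mem_image, not_exists, not_and]
    exact fun j _ h => hx j h.symm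
  have hb' : ∀ i j, i ≠ j → (fun k q => b q k) i j ≠ 0 := fun i j hij => hb j i hij.symm
  simp only [actionCoeff, removalFactor, hS,
    weight_erase hb hb0 (Finset.mem_union_left _ hk) (hx _),
    weight_erase hb' hb0 (Finset.mem_union_left _ hk) (hx _), Finset.prod_mul_distrib]
  ring

lemma image_Iio_succ {m : ℕ} (S : Finset ι) (x : Fin (m + 1) → ι) (t : Fin m) :
    S ∪ (Finset.Iio t.succ).image x
      = insert (x 0) S ∪ (Finset.Iio t).image (fun j => x j.succ) := by
  ext i
  simp [Fin.exists_fin_succ, or_left_comm, eq_comm]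

lemma actionCoeff_succ {m r s : ℕ} (S : Finset ι) (x : Fin (m + 1) → ι) (u : Fin r → Fin m)
    (v : Fin s → Fin m) (p : Fin r → ι) (q : Fin s → ι) :
    actionCoeff b c a d S x (fun i => (u i).succ) (fun j => (v j).succ) p q
      = actionCoeff b c a d (insert (x 0) S) (fun j => x j.succ) u v p q := by
  simp only [actionCoeff, image_Iio_succ]

lemma actionCoeff_cons_left {m r s : ℕ} (S : Finset ι) (x : Fin (m + 1) → ι)
    (u : Fin r → Fin (m + 1)) (v : Fin s → Fin (m + 1)) (p₀ : ι) (p : Fin r → ι) (q : Fin s → ι) :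
    actionCoeff b c a d S x (Fin.cons 0 u) v (Fin.cons p₀ p) q
      = weight a c b S (x 0) p₀ * removalFactor b p q p₀ * actionCoeff b c a d S x u v p q := by
  have h0 : Finset.Iio (0 : Fin (m + 1)) = ∅ := by ext; simp
  simp only [actionCoeff, removalFactor, Fin.prod_univ_succ, Fin.prod_Ioi_zero, Fin.prod_Ioi_succ,
    Fin.cons_zero, Fin.cons_succ, h0, Finset.image_empty, Finset.union_empty]
  ring

lemma actionCoeff_cons_right {m r s : ℕ} (S : Finset ι) (x : Fin (m + 1) → ι)
    (u : Fin r → Fin (m + 1)) (v : Fin s → Fin (m + 1)) (p : Fin r → ι) (q₀ : ι) (q : Fin s → ι) :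
    actionCoeff b c a d S x u (Fin.cons 0 v) p (Fin.cons q₀ q)
      = weight d (fun x q => c q x) (fun k q => b q k) S (x 0) q₀ * removalFactor b p q q₀
          * actionCoeff b c a d S x u v p q := by
  have h0 : Finset.Iio (0 : Fin (m + 1)) = ∅ := by ext; simp
  simp only [actionCoeff, removalFactor, Fin.prod_univ_succ, Fin.prod_Ioi_zero, Fin.prod_Ioi_succ,
    Fin.cons_zero, Fin.cons_succ, h0, Finset.image_empty, Finset.union_empty,
    Finset.prod_mul_distrib]
  ring

omit [DecidableEq ι] in
lemma removalFactor_cons_left {r s : ℕ} (p₀ : ι) (p : Fin r → ι) (q : Fin s → ι) (k : ι) :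
    removalFactor b (Fin.cons p₀ p) q k = b k p₀ * removalFactor b p q k := by
  simp only [removalFactor, Fin.prod_univ_succ, Fin.cons_zero, Fin.cons_succ]
  ring

/-- The set of indices that remains after the action. -/
def remainingSet {m r s : ℕ} (S : Finset ι) (x : Fin m → ι) (p : Fin r → ι) (q : Fin s → ι) :
    Finset ι :=
  (S ∪ Finset.univ.image x) \ (Finset.univ.image p ∪ Finset.univ.image q)

lemma union_image_succ {m : ℕ} (S : Finset ι) (x : Fin (m + 1) → ι) :
    S ∪ Finset.univ.image x = insert (x 0) S ∪ Finset.univ.image (fun j : Fin m => x j.succ) := by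
  ext i
  simp [Fin.exists_fin_succ, or_left_comm, eq_comm]

lemma remainingSet_succ {m r s : ℕ} (S : Finset ι) (x : Fin (m + 1) → ι) (p : Fin r → ι)
    (q : Fin s → ι) :
    remainingSet S x p q = remainingSet (insert (x 0) S) (fun j => x j.succ) p q := by
  rw [remainingSet, union_image_succ, remainingSet]

lemma remainingSet_cons_left {m r s : ℕ} {S : Finset ι} {x : Fin m → ι} {k : ι}
    (hx : ∀ j, k ≠ x j) (p : Fin r → ι) (q : Fin s → ι) :
    remainingSet S x (Fin.cons k p : Fin (r + 1) → ι) q = remainingSet (S.erase k) x p q := by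
  ext i
  simp only [remainingSet, Finset.mem_sdiff, Finset.mem_union, Finset.mem_image, Finset.mem_univ,
    true_and, Fin.exists_fin_succ, Fin.cons_zero, Fin.cons_succ, Finset.mem_erase]
  by_cases hi : i = k
  · subst hi
    simp only [true_or, not_true, and_false, ne_eq, false_and, false_or, false_iff, not_and]
    rintro ⟨j, hj⟩
    exact absurd hj.symm (hx j)
  · simp [hi, Ne.symm hi, eq_comm]

lemma remainingSet_cons_right {m r s : ℕ} {S : Finset ι} {x : Fin m → ι} {k : ι}
    (hx : ∀ j, k ≠ x j) (p : Fin r → ι) (q : Fin s → ι) :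
    remainingSet S x p (Fin.cons k q : Fin (s + 1) → ι) = remainingSet (S.erase k) x p q := by
  have := remainingSet_cons_left (S := S) hx q p
  rw [remainingSet, Finset.union_comm (Finset.image _ _)] at this
  rw [remainingSet, this, remainingSet, Finset.union_comm (Finset.image q _), remainingSet]

end Coefficients

lemma sum_fin_succ_arrow {ι E : Type*} [Fintype ι] [AddCommMonoid E] {r : ℕ}
    (f : (Fin (r + 1) → ι) → E) : ∑ p, f p = ∑ p₀, ∑ p : Fin r → ι, f (Fin.cons p₀ p) := by
  rw [← (Fin.consEquiv fun _ => ι).sum_comp, Fintype.sum_prod_type]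
  rfl

/-- A strictly increasing sequence of positions either avoids the first position or begins
with it. -/
lemma strictMono_fin_cases {r m : ℕ} {u : Fin r → Fin (m + 1)} (hu : StrictMono u) :
    (∃ u' : Fin r → Fin m, StrictMono u' ∧ u = fun i => (u' i).succ) ∨
    ∃ (r' : ℕ) (e : r = r' + 1) (u' : Fin r' → Fin m), StrictMono u' ∧
      u = fun i => (Fin.cons 0 (fun i => (u' i).succ) : Fin (r' + 1) → Fin (m + 1)) (i.cast e) := by
  by_cases h : ∀ i, u i ≠ 0
  · exact Or.inl ⟨fun i => (u i).pred (h i), fun i j hij => by simpa using hu hij, by simp⟩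
  · push Not at h
    obtain ⟨i₀, hi₀⟩ := h
    cases r with
    | zero => exact i₀.elim0
    | succ r' =>
      have hpos (i : Fin r') : u i.succ ≠ 0 := by
        have := hu (Fin.succ_pos i)
        exact (lt_of_le_of_lt (Fin.zero_le _) this).ne'
      have hi : i₀ = 0 := by
        refine Fin.cases (fun _ => rfl) (fun i h => absurd h (hpos i)) i₀ hi₀
      subst hi
      refine Or.inr ⟨r', rfl, fun i => (u i.succ).pred (hpos i), fun i j hij => ?_, ?_⟩
      · simpa using hu (Fin.succ_lt_succ_iff.mpr hij)
      · funext i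
        refine Fin.cases ?_ (fun i => ?_) i <;> simp [hi₀]

namespace VacuumRep

variable {ι n : Type*} [Fintype n] [DecidableEq n] [DecidableEq ι] [Fintype ι]
  {T : ι → Matrix (Fin 2) (Fin 2) (Matrix n n ℂ)} {v : n → ℂ} {b c : ι → ι → ℂ} {a d : ι → ℂ}
  (h : VacuumRep T v b c a d)

lemma state_vecMul_A_eq_sum {S : Finset ι} {x : ι} (hx : x ∉ S) :
    h.state S ᵥ* T x 0 0 = ∑ p, weight a c b S x p • h.state ((insert x S).erase p) := by
  simp only [weight, ite_smul, zero_smul, Finset.sum_ite_mem, Finset.univ_inter,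
    h.state_vecMul_A S x hx]

lemma state_vecMul_D_eq_sum {S : Finset ι} {x : ι} (hx : x ∉ S) :
    h.state S ᵥ* T x 1 1 = ∑ q, weight d (fun x q => c q x) (fun k q => b q k) S x q
      • h.state ((insert x S).erase q) := by
  simp only [weight, ite_smul, zero_smul, Finset.sum_ite_mem, Finset.univ_inter,
    h.state_vecMul_D S x hx]

lemma state_vecMul_B_eq_sum {S : Finset ι} {x : ι} (hx : x ∉ S) :
    h.state S ᵥ* T x 0 1
      = ∑ p, ∑ q, (weight a c b S x p * (weight d (fun x q => c q x) (fun k q => b q k) S x q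
          * b q p)) • h.state (((insert x S).erase p).erase q) := by
  simp only [weight, ite_mul, zero_mul, mul_ite, mul_zero, ite_smul, zero_smul, Finset.sum_ite_mem,
    Finset.univ_inter, h.state_vecMul_B S x hx, Finset.sum_ite_irrel, Finset.sum_const_zero]
  refine Finset.sum_congr rfl fun p _ => Finset.sum_congr rfl fun q _ => ?_
  congr 1
  ring

/-- The left action of a product of entries of monodromy matrices. The `u i` are the positions of
the up-spins among the row indices, and the `w j` those of the down-spins among the column
indices, both in increasing order. -/
theorem state_vecMul_prod {m r s : ℕ} (S : Finset ι) (x : Fin m → ι) (hx : Function.Injective x)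
    (hS : ∀ j, x j ∉ S) (al be : Fin m → Fin 2) (u : Fin r → Fin m) (w : Fin s → Fin m)
    (hu : StrictMono u) (hw : StrictMono w) (hal : ∀ j, al j = 0 ↔ ∃ i, u i = j)
    (hbe : ∀ j, be j = 1 ↔ ∃ i, w i = j) :
    h.state S ᵥ* (List.ofFn fun j => T (x j) (al j) (be j)).prod
      = ∑ p : Fin r → ι, ∑ q : Fin s → ι,
          actionCoeff b c a d S x u w p q • h.state (remainingSet S x p q) := by
  induction m generalizing r s S with
  | zero =>
    obtain rfl : r = 0 := by
      cases r with
      | zero => rfl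
      | succ r => exact (u 0).elim0
    obtain rfl : s = 0 := by
      cases s with
      | zero => rfl
      | succ s => exact (w 0).elim0
    simp [actionCoeff, remainingSet]
  | succ m ih =>
    have hx0 : x 0 ∉ S := hS 0
    have hx' : Function.Injective fun j : Fin m => x j.succ :=
      hx.comp (Fin.succ_injective m)
    have hU (j : Fin m) : x j.succ ∉ insert (x 0) S := by
      rw [Finset.mem_insert, not_or]
      exact ⟨fun h' => Fin.succ_ne_zero j (hx h'), hS _⟩
    have hne {k : ι} (hk : k ∈ insert (x 0) S) (j : Fin m) : k ≠ x j.succ := by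
      rintro rfl; exact hU j hk
    have hU' (k : ι) (j : Fin m) : x j.succ ∉ (insert (x 0) S).erase k :=
      fun h' => hU j (Finset.mem_of_mem_erase h')
    rw [List.ofFn_succ, List.prod_cons, ← Matrix.vecMul_vecMul]
    rcases strictMono_fin_cases hu with ⟨u', hu', rfl⟩ | ⟨r', rfl, u', hu', rfl⟩ <;>
    rcases strictMono_fin_cases hw with ⟨w', hw', rfl⟩ | ⟨s', rfl, w', hw', rfl⟩
    · -- the first operator is `C`
      have ha0 : al 0 = 1 := by
        have : al 0 ≠ 0 := by simp [hal]
        omega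
      have hb0 : be 0 = 0 := by
        have : be 0 ≠ 1 := by simp [hbe]
        omega
      rw [ha0, hb0, h.state_vecMul_C hx0,
        ih (insert (x 0) S) _ hx' hU _ _ u' w' hu' hw' (by simp [hal]) (by simp [hbe])]
      simp only [actionCoeff_succ, remainingSet_succ S]
    · -- the first operator is `D`
      simp only [Fin.cast_refl, id] at hbe ⊢
      have ha0 : al 0 = 1 := by
        have : al 0 ≠ 0 := by simp [hal]
        omega
      have hb0 : be 0 = 1 := by rw [hbe]; exact ⟨0, by simp⟩
      have hbe' (j : Fin m) : be j.succ = 1 ↔ ∃ i, w' i = j := by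
        simp [hbe, Fin.exists_fin_succ, (Fin.succ_ne_zero j).symm]
      rw [ha0, hb0, h.state_vecMul_D_eq_sum hx0, Matrix.sum_vecMul]
      simp only [sum_fin_succ_arrow (r := s')]
      rw [Finset.sum_comm]
      refine Finset.sum_congr rfl fun k _ => ?_
      by_cases hk : k ∈ insert (x 0) S
      · rw [Matrix.smul_vecMul, ih _ _ hx' (hU' k) _ _ u' w' hu' hw' (by simp [hal]) hbe']
        simp only [Finset.smul_sum, actionCoeff_cons_right, actionCoeff_succ, remainingSet_succ S,
          remainingSet_cons_right (hne hk), actionCoeff_erase h.b_ne h.b_self hk (hne hk)]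
        refine Finset.sum_congr rfl fun p _ => Finset.sum_congr rfl fun q _ => ?_
        rw [smul_smul]
        congr 1
        ring
      · simp [actionCoeff_cons_right, weight_of_notMem hk]
    · -- the first operator is `A`
      simp only [Fin.cast_refl, id] at hal ⊢
      have ha0 : al 0 = 0 := by rw [hal]; exact ⟨0, by simp⟩
      have hb0 : be 0 = 0 := by
        have : be 0 ≠ 1 := by simp [hbe]
        omega
      have hal' (j : Fin m) : al j.succ = 0 ↔ ∃ i, u' i = j := by
        simp [hal, Fin.exists_fin_succ, (Fin.succ_ne_zero j).symm]
      rw [ha0, hb0, h.state_vecMul_A_eq_sum hx0, Matrix.sum_vecMul]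
      simp only [sum_fin_succ_arrow (r := r')]
      refine Finset.sum_congr rfl fun k _ => ?_
      by_cases hk : k ∈ insert (x 0) S
      · rw [Matrix.smul_vecMul, ih _ _ hx' (hU' k) _ _ u' w' hu' hw' hal' (by simp [hbe])]
        simp only [Finset.smul_sum, actionCoeff_cons_left, actionCoeff_succ, remainingSet_succ S,
          remainingSet_cons_left (hne hk), actionCoeff_erase h.b_ne h.b_self hk (hne hk)]
        refine Finset.sum_congr rfl fun p _ => Finset.sum_congr rfl fun q _ => ?_
        rw [smul_smul]
        congr 1
        ring
      · simp [actionCoeff_cons_left, weight_of_notMem hk]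
    · -- the first operator is `B`
      simp only [Fin.cast_refl, id] at hal hbe ⊢
      have ha0 : al 0 = 0 := by rw [hal]; exact ⟨0, by simp⟩
      have hb0 : be 0 = 1 := by rw [hbe]; exact ⟨0, by simp⟩
      have hal' (j : Fin m) : al j.succ = 0 ↔ ∃ i, u' i = j := by
        simp [hal, Fin.exists_fin_succ, (Fin.succ_ne_zero j).symm]
      have hbe' (j : Fin m) : be j.succ = 1 ↔ ∃ i, w' i = j := by
        simp [hbe, Fin.exists_fin_succ, (Fin.succ_ne_zero j).symm]
      rw [ha0, hb0, h.state_vecMul_B_eq_sum hx0, Matrix.sum_vecMul]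
      simp only [sum_fin_succ_arrow (r := r'), sum_fin_succ_arrow (r := s'), Matrix.sum_vecMul]
      refine Finset.sum_congr rfl fun k _ => ?_
      rw [Finset.sum_comm]
      refine Finset.sum_congr rfl fun l _ => ?_
      simp only [actionCoeff_cons_left, actionCoeff_cons_right, removalFactor_cons_left,
        actionCoeff_succ, remainingSet_succ S]
      by_cases hk : k ∈ insert (x 0) S
      · by_cases hl : l ∈ insert (x 0) S
        · by_cases hkl : l = k
          · subst hkl
            simp [h.b_self]
          · have hl' : l ∈ (insert (x 0) S).erase k := Finset.mem_erase.mpr ⟨hkl, hl⟩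
            rw [Matrix.smul_vecMul, ih _ _ hx' (fun j h' => hU' k j (Finset.mem_of_mem_erase h'))
              _ _ u' w' hu' hw' hal' hbe']
            simp only [Finset.smul_sum, remainingSet_cons_left (hne hk),
              remainingSet_cons_right (hne hl), actionCoeff_erase h.b_ne h.b_self hk (hne hk),
              actionCoeff_erase h.b_ne h.b_self hl' (hne hl)]
            refine Finset.sum_congr rfl fun p _ => Finset.sum_congr rfl fun q _ => ?_
            rw [smul_smul]
            congr 1
            ring
        · simp [weight_of_notMem hl]
      · simp [weight_of_notMem hk]

end VacuumRep

/-! ### Splitting the indices into up-spins and down-spins -/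

section Splitting

variable {m r s : ℕ} (hz : r + s = m)

lemma prod_split (F : Fin m → ℂ) :
    ∏ j, F j
      = (∏ i, F (Fin.cast hz (Fin.castAdd s i))) * ∏ j, F (Fin.cast hz (Fin.natAdd r j)) := by
  subst hz
  simp [Fin.prod_univ_add]

lemma exists_split (P : Fin m → Prop) : (∃ j, P j)
    ↔ (∃ i : Fin r, P (Fin.cast hz (Fin.castAdd s i.rev)))
      ∨ ∃ j : Fin s, P (Fin.cast hz (Fin.natAdd r j)) := by
  subst hz
  constructor
  · rintro ⟨j, hj⟩
    induction j using Fin.addCases with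
    | left i => exact Or.inl ⟨i.rev, by simpa using hj⟩
    | right j => exact Or.inr ⟨j, by simpa using hj⟩
  · rintro (⟨i, hi⟩ | ⟨j, hj⟩)
    · exact ⟨_, hi⟩
    · exact ⟨_, hj⟩

/-- The order of the first `r` indices is reversed, as the up-spins are numbered from the last to
the first. -/
lemma prod_pairs_split {ι : Type*} (g : ι → ι → ℂ) (ℓ : Fin m → ι) :
    ∏ j, ∏ k ∈ Finset.Ioi j, g (ℓ k) (ℓ j)
      = (∏ i : Fin r, ∏ i' ∈ Finset.Ioi i, g (ℓ (Fin.cast hz (Fin.castAdd s i.rev)))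
            (ℓ (Fin.cast hz (Fin.castAdd s i'.rev))))
        * (∏ i : Fin r, ∏ j : Fin s, g (ℓ (Fin.cast hz (Fin.natAdd r j)))
            (ℓ (Fin.cast hz (Fin.castAdd s i.rev))))
        * ∏ j : Fin s, ∏ j' ∈ Finset.Ioi j, g (ℓ (Fin.cast hz (Fin.natAdd r j')))
            (ℓ (Fin.cast hz (Fin.natAdd r j))) := by
  subst hz
  have hI {n : ℕ} (i : Fin n) (f : Fin n → ℂ) :
      ∏ k ∈ Finset.Ioi i, f k = ∏ k, if i < k then f k else 1 := by
    rw [← Finset.prod_filter]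
    congr 1
    ext; simp
  have h1 (i : Fin r) (j : Fin s) : Fin.castAdd s i < Fin.natAdd r j := by
    rw [Fin.lt_def, Fin.val_castAdd, Fin.val_natAdd]
    omega
  have h2 (i : Fin r) (j : Fin s) : ¬ Fin.natAdd r j < Fin.castAdd s i := (h1 i j).not_gt
  have h3 (i i' : Fin r) : Fin.castAdd s i < Fin.castAdd s i' ↔ i < i' := Iff.rfl
  have h4 (j j' : Fin s) : Fin.natAdd r j < Fin.natAdd r j' ↔ j < j' := by
    rw [Fin.lt_def, Fin.lt_def, Fin.val_natAdd, Fin.val_natAdd, Nat.add_lt_add_iff_left]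
  simp only [hI, Fin.prod_univ_add, h1, h2, h3, h4, if_true, if_false, Finset.prod_const_one,
    mul_one, Fin.cast_refl, id, Finset.prod_mul_distrib]
  rw [← mul_assoc]
  congr 2
  · rw [Finset.prod_comm, ← Equiv.prod_comp Fin.revPerm]
    refine Finset.prod_congr rfl fun i _ => ?_
    rw [← Equiv.prod_comp Fin.revPerm]
    simp
  · rw [← Equiv.prod_comp Fin.revPerm]
    simp

lemma sum_split {ι E : Type*} [Fintype ι] [AddCommMonoid E]
    (G : (Fin r → ι) → (Fin s → ι) → E) :
    ∑ p, ∑ q, G p q = ∑ ℓ : Fin m → ι, G (fun i => ℓ (Fin.cast hz (Fin.castAdd s i.rev)))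
      fun j => ℓ (Fin.cast hz (Fin.natAdd r j)) := by
  subst hz
  rw [← Fintype.sum_prod_type', ← (Fin.appendEquiv r s).sum_comp]
  refine Fintype.sum_equiv ((Equiv.arrowCongr Fin.revPerm (Equiv.refl ι)).prodCongr
    (Equiv.refl _)) _ _ ?_
  rintro ⟨p, q⟩
  simp [Fin.appendEquiv, Function.comp_def]

end Splitting

/-! ### The weights in terms of hyperbolic functions -/

section Weights

variable {m : ℕ} {f g : Fin m → ℂ} {τ : ℂ} {t : Fin m}

lemma prod_Iic_div_of_ne_zero (hf : ∀ k, f k ≠ 0) (hg : g t ≠ 0) :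
    τ / g t * ∏ k ∈ Finset.Iic t, g k / f k
      = τ * ((∏ k, 1 / f k) * ((∏ k ∈ Finset.Iio t, g k) * ∏ k ∈ Finset.Ioi t, f k)) := by
  have h1 : Finset.Iic t = insert t (Finset.Iio t) := by ext; simp [le_iff_eq_or_lt]
  have h2 : (Finset.univ : Finset (Fin m)) = Finset.Ioi t ∪ insert t (Finset.Iio t) := by
    ext k; simpa using lt_or_ge t k
  have h3 : Disjoint (Finset.Ioi t) (insert t (Finset.Iio t)) := by
    rw [← h1, Finset.disjoint_left]; simp
  have h4 : ∏ k ∈ Finset.Ioi t, f k ≠ 0 := Finset.prod_ne_zero_iff.mpr fun k _ => hf k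
  have h5 : ∏ k ∈ Finset.Iio t, f k ≠ 0 := Finset.prod_ne_zero_iff.mpr fun k _ => hf k
  rw [h1, h2, Finset.prod_union h3, Finset.prod_insert (by simp), Finset.prod_insert (by simp)]
  simp only [one_div, Finset.prod_inv_distrib, Finset.prod_div_distrib]
  field_simp [hf t]

lemma prod_Iic_div_of_eq_zero (hτ : τ ≠ 0) {k₀ : Fin m} (h₀ : f k₀ = 0) (hg₀ : g k₀ = τ)
    (hf : ∀ k, k ≠ k₀ → f k ≠ 0) (hg : g t ≠ 0) :
    (if k₀ ≤ t then τ / g t * ∏ k ∈ Finset.Iic t with k ≠ k₀, g k / f k else 0)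
      = (∏ k with k ≠ k₀, 1 / f k)
          * ((∏ k ∈ Finset.Iio t, g k) * ∏ k ∈ Finset.Ioi t, f k) := by
  split_ifs with h
  · -- reduce to the case of a nonvanishing `f` by setting `f k₀ = 1`
    have key := prod_Iic_div_of_ne_zero (f := Function.update f k₀ 1) (g := g) (τ := τ) (t := t)
      (fun k => by
        by_cases hk : k = k₀
        · subst hk; simp
        · simpa [hk] using hf k hk) hg
    have e1 (s : Finset (Fin m)) (F : Fin m → ℂ → ℂ) (hs : k₀ ∈ s) :
        ∏ k ∈ s, F k (Function.update f k₀ 1 k) = F k₀ 1 * ∏ k ∈ s with k ≠ k₀, F k (f k) := by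
      rw [← Finset.mul_prod_erase _ _ hs, Function.update_self, ← Finset.filter_ne']
      congr 1
      refine Finset.prod_congr rfl fun k hk => ?_
      rw [Function.update_of_ne (Finset.mem_filter.mp hk).2]
    have e2 : ∏ k ∈ Finset.Ioi t, Function.update f k₀ 1 k = ∏ k ∈ Finset.Ioi t, f k := by
      refine Finset.prod_congr rfl fun k hk => ?_
      rw [Function.update_of_ne]
      rintro rfl
      exact absurd (Finset.mem_Ioi.mp hk) h.not_gt
    rw [e1 _ (fun k y => g k / y) (Finset.mem_Iic.mpr h), e1 _ (fun _ y => 1 / y)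
      (Finset.mem_univ _), e2, hg₀, div_one, div_one, one_mul] at key
    refine mul_left_cancel₀ hτ ?_
    rw [← key]
    ring
  · rw [Finset.prod_eq_zero (i := k₀) (s := Finset.Ioi t) (by simpa using h) h₀]
    simp

end Weights

/-- The indices of the initial state together with those of the first inhomogeneities form an
initial segment. -/
lemma insert_natAdd_eq_filter {M m : ℕ} (t : Fin m) :
    insert (Fin.natAdd M t) (Finset.univ.image (Fin.castAdd m)
        ∪ (Finset.Iio t).image (Fin.natAdd M))
      = Finset.univ.filter fun k : Fin (M + m) => (k : ℕ) ≤ M + t := by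
  ext k
  refine Fin.addCases (fun k => ?_) (fun k => ?_) k
  · have (j : Fin m) : Fin.natAdd M j ≠ Fin.castAdd m k := by
      simp [Fin.ext_iff]; omega
    have h2 : (k : ℕ) ≤ M + t := by omega
    simp [h2]
  · have (j : Fin M) : Fin.castAdd m j ≠ Fin.natAdd M k := by
      simp [Fin.ext_iff]; omega
    simp [this, le_iff_eq_or_lt, Fin.val_inj]

lemma invProd_segment {M m : ℕ} (g : Fin (M + m) → Fin (M + m) → ℂ) (t : Fin m)
    (p : Fin (M + m)) :
    invProd g (Finset.univ.filter fun k : Fin (M + m) => (k : ℕ) ≤ M + t) p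
      = (∏ k : Fin M with Fin.castAdd m k ≠ p, (g (Fin.castAdd m k) p)⁻¹)
        * ∏ k ∈ Finset.Iic t with Fin.natAdd M k ≠ p, (g (Fin.natAdd M k) p)⁻¹ := by
  have h1 : Finset.Iic t = Finset.univ.filter fun k => k ≤ t := by ext; simp
  rw [invProd, ← Finset.filter_ne', Finset.filter_filter, h1, Finset.filter_filter,
    Finset.prod_filter, Finset.prod_filter, Finset.prod_filter, Fin.prod_univ_add]
  congr 1
  · refine Finset.prod_congr rfl fun k _ => ?_
    have h2 : (k : ℕ) ≤ M + t := by omega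
    simp [h2]
  · refine Finset.prod_congr rfl fun k _ => ?_
    simp

/-! ### The coefficients of the expansion -/

section Coefficients

variable {N : ℕ} {η β φ : ℂ} {M m : ℕ} {lam : Fin (M + m) → ℂ}

/-- The contribution of `-sh(η)` and of the inhomogeneities to the weight of an up-spin (`κ = -η`)
or of a down-spin (`κ = η`) at position `t`. -/
lemma weight_xi_eq {κ : ℂ} (hκ : sinh κ ≠ 0)
    (hdist : ∀ j k, j ≠ k → sinh (lam j - lam k) ≠ 0)
    (hκd : ∀ j k, j ≠ k → sinh (lam j - lam k + κ) ≠ 0) (t : Fin m) (p : Fin (M + m)) :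
    (if (p : ℕ) ≤ M + t then sinh κ / sinh (lam p - xi lam t + κ)
        * ∏ k ∈ Finset.Iic t with Fin.natAdd M k ≠ p,
          sinh (lam p - xi lam k + κ) / sinh (lam p - xi lam k) else 0)
      = (if (p : ℕ) < M then sinh κ else 1)
        * ((∏ k : Fin m with Fin.natAdd M k ≠ p, 1 / sinh (lam p - xi lam k))
          * ((∏ k ∈ Finset.Iio t, sinh (lam p - xi lam k + κ))
            * ∏ k ∈ Finset.Ioi t, sinh (lam p - xi lam k))) := by
  have hg (k : Fin m) : sinh (lam p - xi lam k + κ) ≠ 0 := by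
    by_cases hk : p = Fin.natAdd M k
    · rw [hk, xi, sub_self, zero_add]; exact hκ
    · exact hκd _ _ hk
  refine Fin.addCases (fun p₀ hg => ?_) (fun k₀ hg => ?_) p hg
  · have hne (k : Fin m) : Fin.natAdd M k ≠ Fin.castAdd m p₀ := by
      simp [Fin.ext_iff]; omega
    have hle : (p₀ : ℕ) ≤ M + t := by omega
    simp only [hne, ne_eq, not_false_eq_true, Finset.filter_true, Fin.val_castAdd, hle, if_true,
      p₀.isLt]
    exact prod_Iic_div_of_ne_zero (f := fun k => sinh (lam (Fin.castAdd m p₀) - xi lam k))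
      (g := fun k => sinh (lam (Fin.castAdd m p₀) - xi lam k + κ))
      (fun k => hdist _ _ (hne k).symm) (hg t)
  · have hlt : ¬ M + (k₀ : ℕ) < M := by omega
    simp only [ne_eq, Fin.natAdd_inj, Fin.val_natAdd, hlt, if_false, one_mul,
      Nat.add_le_add_iff_left, Fin.val_fin_le]
    refine prod_Iic_div_of_eq_zero (f := fun k => sinh (lam (Fin.natAdd M k₀) - xi lam k))
      (g := fun k => sinh (lam (Fin.natAdd M k₀) - xi lam k + κ)) hκ
      (by simp [xi]) (by simp [xi]) (fun k hk => ?_) (hg t)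
    exact hdist _ _ fun h => hk (by simpa using h.symm)

/-- The weight of an up-spin at position `t`. -/
lemma weight_up_eq (hη : sinh η ≠ 0) (hdist : ∀ j k, j ≠ k → sinh (lam j - lam k) ≠ 0)
    (hdistη : ∀ j k, j ≠ k → sinh (lam j - lam k + η) ≠ 0) (t : Fin m) (p : Fin (M + m)) :
    weight (fun i => a N η β φ (lam i)) (fun i j => c η (lam i) (lam j))
        (fun i j => b η (lam i) (lam j))
        (Finset.univ.image (Fin.castAdd m) ∪ (Finset.Iio t).image (Fin.natAdd M)) (Fin.natAdd M t) p
      = (if (p : ℕ) < M then -sinh η else 1)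
        * (a N η β φ (lam p)
          * ∏ k : Fin M with Fin.castAdd m k ≠ p, 1 / b η (lam (Fin.castAdd m k)) (lam p))
        * (∏ k : Fin m with Fin.natAdd M k ≠ p, 1 / sinh (lam p - xi lam k))
        * ((∏ k ∈ Finset.Iio t, sinh (lam p - xi lam k - η))
          * ∏ k ∈ Finset.Ioi t, sinh (lam p - xi lam k)) := by
  have hneg (x y : ℂ) : sinh (x - y + -η) = -sinh (y - x + η) := by
    rw [← sinh_neg]; congr 1; ring
  have hneg' (x y : ℂ) : sinh (x - y) = -sinh (y - x) := by
    rw [← sinh_neg]; congr 1; ring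
  have key := weight_xi_eq (κ := -η) (by simpa using hη) hdist
    (fun j k hjk => by rw [hneg]; exact neg_ne_zero.mpr (hdistη k j hjk.symm)) t p
  have hc : c η (lam (Fin.natAdd M t)) (lam p) = sinh (-η) / sinh (lam p - xi lam t + -η) := by
    rw [hneg, sinh_neg, neg_div_neg_eq, c, xi]
  have hb (k : Fin m) : (b η (lam (Fin.natAdd M k)) (lam p))⁻¹
      = sinh (lam p - xi lam k + -η) / sinh (lam p - xi lam k) := by
    rw [hneg, hneg' (lam p), neg_div_neg_eq, b, xi, inv_div]
  rw [weight, insert_natAdd_eq_filter, invProd_segment]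
  simp only [Finset.mem_filter, Finset.mem_univ, true_and, one_div, hc, hb, sub_eq_add_neg _ η,
    sinh_neg] at key ⊢
  by_cases hp : (p : ℕ) ≤ M + t
  · simp only [hp, if_true] at key ⊢
    linear_combination (a N η β φ (lam p)
      * ∏ k : Fin M with Fin.castAdd m k ≠ p, (b η (lam (Fin.castAdd m k)) (lam p))⁻¹) * key
  · simp only [hp, if_false] at key ⊢
    linear_combination (a N η β φ (lam p)
      * ∏ k : Fin M with Fin.castAdd m k ≠ p, (b η (lam (Fin.castAdd m k)) (lam p))⁻¹) * key

lemma a_ne_zero {l : ℂ} (h : sinh (l + β / N) ≠ 0) (h' : sinh (-(β / N) - l + η) ≠ 0) :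
    a N η β φ l ≠ 0 := by
  have : sinh (-(β / N) - l) ≠ 0 := by
    rw [show -(β / N) - l = -(l + β / N) by ring, sinh_neg]
    exact neg_ne_zero.mpr h
  exact mul_ne_zero (exp_ne_zero _) (pow_ne_zero _ (b_ne_zero this h'))

/-- The function `𝔟_M` turns the vacuum eigenvalue `a` and its factors into those of `d`. If `p`
is one of the first `M` indices, then the factor `k = p` of `𝔟_M` gives `-1`. -/
lemma bM_mul_a (hη : sinh η ≠ 0)
    (hdistη : ∀ j k, j ≠ k → sinh (lam j - lam k + η) ≠ 0) {p : Fin (M + m)}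
    (ha : a N η β φ (lam p) ≠ 0) :
    bM N η β φ (fun k : Fin M => lam (Fin.castAdd m k)) (lam p) * (a N η β φ (lam p)
        * ∏ k : Fin M with Fin.castAdd m k ≠ p, 1 / b η (lam (Fin.castAdd m k)) (lam p))
      = (if (p : ℕ) < M then -1 else 1) * (d N η β φ (lam p)
        * ∏ k : Fin M with Fin.castAdd m k ≠ p, (b η (lam p) (lam (Fin.castAdd m k)))⁻¹) := by
  have h1 : ∏ k : Fin M, sinh (lam p - lam (Fin.castAdd m k) + η)
        / sinh (lam p - lam (Fin.castAdd m k) - η)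
      = (if (p : ℕ) < M then -1 else 1) * ∏ k : Fin M with Fin.castAdd m k ≠ p,
        sinh (lam p - lam (Fin.castAdd m k) + η) / sinh (lam p - lam (Fin.castAdd m k) - η) := by
    refine Fin.addCases (fun p => ?_) (fun p => ?_) p
    · simp only [ne_eq, Fin.castAdd_inj, Fin.val_castAdd, p.isLt, if_true]
      rw [Finset.filter_ne', ← Finset.mul_prod_erase _ _ (Finset.mem_univ p), sub_self, zero_add,
        zero_sub, sinh_neg, div_neg, div_self hη]
    · have (j : Fin M) : Fin.castAdd m j ≠ Fin.natAdd M p := by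
        simp [Fin.ext_iff]; omega
      simp [this]
  have h2 (k : Fin M) (hk : Fin.castAdd m k ≠ p) :
      sinh (lam p - lam (Fin.castAdd m k) + η) / sinh (lam p - lam (Fin.castAdd m k) - η)
        * (1 / b η (lam (Fin.castAdd m k)) (lam p)) = (b η (lam p) (lam (Fin.castAdd m k)))⁻¹ := by
    have e1 : lam p - lam (Fin.castAdd m k) - η = -(lam (Fin.castAdd m k) - lam p + η) := by ring
    have e2 : lam p - lam (Fin.castAdd m k) = -(lam (Fin.castAdd m k) - lam p) := by ring
    have e3 := hdistη _ _ hk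
    rw [b, b, e1, sinh_neg, inv_div, one_div_div, e2, sinh_neg (_ - _)]
    field_simp
  rw [bM, h1, ← Finset.prod_congr rfl fun k hk => h2 k (Finset.mem_filter.mp hk).2,
    Finset.prod_mul_distrib]
  field_simp

/-- The weight of a down-spin at position `t`. -/
lemma weight_down_eq (hη : sinh η ≠ 0) (hdist : ∀ j k, j ≠ k → sinh (lam j - lam k) ≠ 0)
    (hdistη : ∀ j k, j ≠ k → sinh (lam j - lam k + η) ≠ 0) (t : Fin m) (p : Fin (M + m))
    (ha : a N η β φ (lam p) ≠ 0) :
    weight (fun i => d N η β φ (lam i)) (fun i j => c η (lam j) (lam i))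
        (fun i j => b η (lam j) (lam i))
        (Finset.univ.image (Fin.castAdd m) ∪ (Finset.Iio t).image (Fin.natAdd M)) (Fin.natAdd M t) p
      = (if (p : ℕ) < M then -sinh η else 1)
        * bM N η β φ (fun k : Fin M => lam (Fin.castAdd m k)) (lam p)
        * (a N η β φ (lam p)
          * ∏ k : Fin M with Fin.castAdd m k ≠ p, 1 / b η (lam (Fin.castAdd m k)) (lam p))
        * (∏ k : Fin m with Fin.natAdd M k ≠ p, 1 / sinh (lam p - xi lam k))
        * ((∏ k ∈ Finset.Iio t, sinh (lam p - xi lam k + η))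
          * ∏ k ∈ Finset.Ioi t, sinh (lam p - xi lam k)) := by
  have key := weight_xi_eq hη hdist hdistη t p
  have hc : c η (lam p) (lam (Fin.natAdd M t)) = sinh η / sinh (lam p - xi lam t + η) := rfl
  have hb (k : Fin m) : (b η (lam p) (lam (Fin.natAdd M k)))⁻¹
      = sinh (lam p - xi lam k + η) / sinh (lam p - xi lam k) := by
    rw [b, xi, inv_div]
  have hs : (if (p : ℕ) < M then -sinh η else 1) * (if (p : ℕ) < M then -1 else 1)
      = if (p : ℕ) < M then sinh η else 1 := by split_ifs <;> simp
  have hbM := bM_mul_a (N := N) (φ := φ) hη hdistη ha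
  rw [weight, insert_natAdd_eq_filter, invProd_segment]
  simp only [Finset.mem_filter, Finset.mem_univ, true_and, hc, hb]
  generalize (∏ k : Fin m with Fin.natAdd M k ≠ p, 1 / sinh (lam p - xi lam k)) = X at key ⊢
  generalize ((∏ k ∈ Finset.Iio t, sinh (lam p - xi lam k + η))
          * ∏ k ∈ Finset.Ioi t, sinh (lam p - xi lam k)) = Y at key ⊢
  set P := ∏ k : Fin M with Fin.castAdd m k ≠ p, (b η (lam p) (lam (Fin.castAdd m k)))⁻¹
  set s := if (p : ℕ) < M then -sinh η else 1
  by_cases hp : (p : ℕ) ≤ M + t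
  · simp only [hp, if_true] at key ⊢
    linear_combination (d N η β φ (lam p) * P) * key - (d N η β φ (lam p) * P * X * Y) * hs
      - (s * X * Y) * hbM
  · simp only [hp, if_false] at key ⊢
    linear_combination (d N η β φ (lam p) * P) * key - (d N η β φ (lam p) * P * X * Y) * hs
      - (s * X * Y) * hbM

end Coefficients

section Coefficients

variable {N : ℕ} {η β φ : ℂ} {M m : ℕ} {lam : Fin (M + m) → ℂ}

lemma pow_ellPlus_eq (x : ℂ) (ℓ : Fin m ↪ Fin (M + m)) :
    x ^ ellPlus ℓ = ∏ j, if (ℓ j : ℕ) < M then x else 1 := by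
  rw [ellPlus, Finset.filter_image, Finset.card_image_of_injective _ ℓ.injective,
    Finset.prod_ite, Finset.prod_const, Finset.prod_const_one, mul_one]

/-- The coefficients of the two expansions agree if the up-spins are numbered backwards. -/
lemma coeff_eq_actionCoeff (hη : sinh η ≠ 0) (hdist : ∀ j k, j ≠ k → sinh (lam j - lam k) ≠ 0)
    (hdistη : ∀ j k, j ≠ k → sinh (lam j - lam k + η) ≠ 0)
    (ha : ∀ j, a N η β φ (lam j) ≠ 0) (al be : Fin m → Fin 2)
    (hz : (upSet al).card + (downSet be).card = m) (ℓ : Fin m ↪ Fin (M + m)) :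
    coeff N η β φ lam al be hz ℓ
      = actionCoeff (fun i j => b η (lam i) (lam j)) (fun i j => c η (lam i) (lam j))
          (fun i => a N η β φ (lam i)) (fun i => d N η β φ (lam i))
          (Finset.univ.image (Fin.castAdd m)) (Fin.natAdd M)
          ((upSet al).orderEmbOfFin rfl) ((downSet be).orderEmbOfFin rfl)
          (fun i => ℓ (Fin.cast hz (Fin.castAdd _ i.rev)))
          (fun j => ℓ (Fin.cast hz (Fin.natAdd _ j))) := by
  rw [actionCoeff, ← Equiv.prod_comp Fin.revPerm (fun i => weight _ _ _ _ _ _)]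
  simp only [weight_up_eq hη hdist hdistη, weight_down_eq hη hdist hdistη _ _ (ha _),
    Fin.revPerm_apply, Fin.rev_rev, Finset.prod_mul_distrib]
  rw [coeff, pow_ellPlus_eq, prod_pairs_split hz (fun i j => b η (lam i) (lam j)) ℓ]
  simp only [prod_split hz, Finset.prod_mul_distrib, alphaTilde, betaTilde]
  ring

/-- The coefficients vanish if an index is removed twice, as `b(p, p) = 0`. -/
lemma actionCoeff_eq_zero {ι : Type*} [DecidableEq ι] {b c : ι → ι → ℂ} {a d : ι → ℂ}
    (hb : ∀ i, b i i = 0) {r s : ℕ} (hz : r + s = m) (S : Finset ι) (x : Fin m → ι)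
    (u : Fin r → Fin m) (w : Fin s → Fin m) {ℓ : Fin m → ι} (hℓ : ¬ Function.Injective ℓ) :
    actionCoeff b c a d S x u w (fun i => ℓ (Fin.cast hz (Fin.castAdd _ i.rev)))
      (fun j => ℓ (Fin.cast hz (Fin.natAdd _ j))) = 0 := by
  have h0 : ∏ j, ∏ k ∈ Finset.Ioi j, b (ℓ k) (ℓ j) = 0 := by
    simp only [Function.Injective, not_forall] at hℓ
    obtain ⟨i, j, hij, hne⟩ := hℓ
    wlog hlt : i < j generalizing i j
    · exact this j i hij.symm (Ne.symm hne) (lt_of_le_of_ne (not_lt.mp hlt) (Ne.symm hne))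
    · refine Finset.prod_eq_zero (Finset.mem_univ i) ?_
      exact Finset.prod_eq_zero (Finset.mem_Ioi.mpr hlt) (by rw [hij, hb])
  rw [actionCoeff, mul_assoc, mul_assoc, ← mul_assoc (∏ i, ∏ i' ∈ _, _),
    ← prod_pairs_split hz b ℓ, h0, mul_zero]

end Coefficients

/-! ### The monodromy matrix of the quantum transfer matrix -/

/-- The monodromy matrices at admissible spectral parameters satisfy the relations that determine
the left action. -/
theorem vacuumRep_T {N : ℕ} (hN : Even N) {η β φ : ℂ} (hη : sinh η ≠ 0) {ι : Type*}
    {lam : ι → ℂ} (hdist : ∀ j k, j ≠ k → sinh (lam j - lam k) ≠ 0)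
    (hdistη : ∀ j k, j ≠ k → sinh (lam j - lam k + η) ≠ 0)
    (hpole₁ : ∀ j, sinh (lam j - β / N + η) ≠ 0)
    (hpole₂ : ∀ j, sinh (-(β / N) - lam j + η) ≠ 0) :
    VacuumRep (fun i => T N η β φ (lam i)) (vac N) (fun i j => b η (lam i) (lam j))
      (fun i j => c η (lam i) (lam j)) (fun i => a N η β φ (lam i))
      (fun i => d N η β φ (lam i)) := by
  have hd (j k : ι) : sinh (lam j - lam k + η) ≠ 0 := by
    by_cases h : j = k
    · rw [h, sub_self, zero_add]; exact hη
    · exact hdistη j k h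
  have hT (i j : ι) : Intertwines (R η (lam i) (lam j)) (T N η β φ (lam i)) (T N η β φ (lam j)) :=
    T_intertwines (hd i j) (hpole₁ i) (hpole₂ i) (hpole₁ j) (hpole₂ j)
  refine ⟨fun i => isLeftVacuum_T hN η β φ _, fun i j => ?_, fun i j _ => ?_, fun i j _ => ?_,
    fun i j _ => ?_, fun i => b_self η _, fun i => c_self hη _,
    fun i j hij => b_ne_zero (hdist i j hij) (hd i j),
    fun i j k => b_mul_c_left (hd i j) (hd j k) (hd i k),
    fun i j k => b_mul_c_right (hd i j) (hd j k) (hd i k),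
    fun i j k => c_eq_add (hd i j) (hd j k) (hd i k)⟩
  · have := hT i j (1, 1) (0, 0)
    simp [Fintype.sum_prod_type, R] at this
    exact this
  · have := hT i j (1, 0) (0, 0)
    simp [Fintype.sum_prod_type, R] at this
    rw [← this]; abel
  · have := hT j i (1, 1) (1, 0)
    simp [Fintype.sum_prod_type, R] at this
    rw [this]; abel
  · have := hT i j (1, 0) (0, 1)
    simp [Fintype.sum_prod_type, R] at this
    rw [smul_sub, ← add_sub_assoc, eq_sub_iff_add_eq, add_comm, this, add_comm]

lemma VacuumRep.state_toFinset {ι n : Type*} [Fintype n] [DecidableEq n] [DecidableEq ι]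
    {T : ι → Matrix (Fin 2) (Fin 2) (Matrix n n ℂ)} {v : n → ℂ} {b c : ι → ι → ℂ} {a d : ι → ℂ}
    (h : VacuumRep T v b c a d) {l : List ι} (hl : l.Nodup) :
    h.state l.toFinset = v ᵥ* (l.map fun i => T i 1 0).prod := by
  rw [VacuumRep.state, Finset.noncommProd_toFinset _ _ _ hl]

end XXZ

theorem lemma1 (N : ℕ) (hN : Even N) (hN0 : 0 < N) (η β φ : ℂ) (hη : Complex.sinh η ≠ 0)
    (M m : ℕ) (lam : Fin (M + m) → ℂ)
    -- the `λ_j` are mutually distinct (modulo `iπ`), and no `λ_j - λ_k` is `-η` (modulo `iπ`)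
    (hdist : ∀ j k, j ≠ k → Complex.sinh (lam j - lam k) ≠ 0)
    (hdistη : ∀ j k, j ≠ k → Complex.sinh (lam j - lam k + η) ≠ 0)
    -- no `λ_j` is a pole of the monodromy matrix
    (hpole₁ : ∀ j, Complex.sinh (lam j - β / N + η) ≠ 0)
    (hpole₂ : ∀ j, Complex.sinh (-(β / N) - lam j + η) ≠ 0)
    -- no `λ_j` is a zero of the function `a`
    (ha : ∀ j, Complex.sinh (lam j + β / N) ≠ 0)
    (al be : Fin m → Fin 2)
    (hz : (XXZ.upSet al).card + (XXZ.downSet be).card = m) :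
    Matrix.vecMul (XXZ.vac N)
        ((List.ofFn fun k : Fin M => XXZ.C N η β φ (lam (Fin.castAdd m k))).prod
          * (List.ofFn fun j : Fin m => XXZ.T N η β φ (XXZ.xi lam j) (al j) (be j)).prod)
      = ∑ ℓ : Fin m ↪ Fin (M + m),
          XXZ.coeff N η β φ lam al be hz ℓ
            • Matrix.vecMul (XXZ.vac N) (XXZ.remainingC N η β φ lam ℓ) := by
  have h := XXZ.vacuumRep_T hN (φ := φ) hη hdist hdistη hpole₁ hpole₂
  have hC : XXZ.vac N ᵥ* (List.ofFn fun k : Fin M => XXZ.C N η β φ (lam (Fin.castAdd m k))).prod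
      = h.state (Finset.univ.image (Fin.castAdd m)) := by
    have hl : ((List.finRange M).map (Fin.castAdd m)).Nodup :=
      (List.nodup_finRange M).map (Fin.castAdd_injective M m)
    have hS : ((List.finRange M).map (Fin.castAdd m)).toFinset
        = Finset.univ.image (Fin.castAdd m) := by
      ext; simp
    rw [← hS, h.state_toFinset hl, List.map_map, List.ofFn_eq_map]
    rfl
  have hrem (ℓ : Fin m ↪ Fin (M + m)) : XXZ.vac N ᵥ* XXZ.remainingC N η β φ lam ℓ
      = h.state (XXZ.remainingSet (Finset.univ.image (Fin.castAdd m)) (Fin.natAdd M)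
          (fun i => ℓ (Fin.cast hz (Fin.castAdd _ i.rev)))
          (fun j => ℓ (Fin.cast hz (Fin.natAdd _ j)))) := by
    have hl : ((List.finRange (M + m)).filter fun k => ∀ j, k ≠ ℓ j).Nodup :=
      (List.nodup_finRange _).filter _
    have hS : ((List.finRange (M + m)).filter fun k => ∀ j, k ≠ ℓ j).toFinset
        = XXZ.remainingSet (Finset.univ.image (Fin.castAdd m)) (Fin.natAdd M)
            (fun i => ℓ (Fin.cast hz (Fin.castAdd _ i.rev)))
            (fun j => ℓ (Fin.cast hz (Fin.natAdd _ j))) := by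
      ext k
      have hk : k ∈ Finset.univ.image (Fin.castAdd m) ∪ Finset.univ.image (Fin.natAdd M) := by
        refine Fin.addCases (fun k => ?_) (fun k => ?_) k <;> simp
      have hex := XXZ.exists_split hz fun j => ℓ j = k
      simp only [XXZ.remainingSet, Finset.mem_sdiff, hk, true_and, Finset.mem_union,
        Finset.mem_image, Finset.mem_univ, ← hex, List.mem_toFinset, List.mem_filter,
        List.mem_finRange, decide_eq_true_eq, not_exists, ne_eq, @eq_comm _ k]
    rw [← hS, h.state_toFinset hl]
    rfl
  rw [← Matrix.vecMul_vecMul, hC]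
  refine (h.state_vecMul_prod _ (Fin.natAdd M) (Fin.natAdd_injective m M) (fun j => ?_) al be
    _ _ ((XXZ.upSet al).orderEmbOfFin rfl).strictMono
    ((XXZ.downSet be).orderEmbOfFin rfl).strictMono
    (fun j => ?_) (fun j => ?_)).trans ?_
  · simp [Fin.ext_iff]; omega
  · have := Set.ext_iff.mp ((XXZ.upSet al).range_orderEmbOfFin rfl) j
    simpa [XXZ.upSet] using this.symm
  · have := Set.ext_iff.mp ((XXZ.downSet be).range_orderEmbOfFin rfl) j
    simpa [XXZ.downSet] using this.symm
  · rw [XXZ.sum_split hz]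
    symm
    refine Fintype.sum_of_injective (fun ℓ : Fin m ↪ Fin (M + m) => (ℓ : Fin m → Fin (M + m)))
      DFunLike.coe_injective _ _ (fun ℓ hℓ => ?_) fun ℓ => ?_
    · rw [XXZ.actionCoeff_eq_zero h.b_self hz, zero_smul]
      exact fun hinj => hℓ ⟨⟨ℓ, hinj⟩, rfl⟩
    · rw [hrem, XXZ.coeff_eq_actionCoeff hη hdist hdistη (fun j => XXZ.a_ne_zero (ha j) (hpole₂ j))]
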